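/- Let $G$ be a non-elementary (i.e. not virtually abelian) hyperbolic group. Let $\mathcal D(G)$ be the set of left-invariant, Gromov hyperbolic pseudometrics on $G$ that are quasi-isometric, via the identity map of $G$, to the word metric of some finite generating set. Call $d,d'\in\mathcal D(G)$ roughly similar if $|d-k\,d'|\le A$ for some $k,A>0$; let $\mathscr D(G)$ be the set of rough similarity classes and $[d]$ the class of $d$. For $\rho=[d]$, $\rho'=[d']$ in $\mathscr D(G)$ put $$\Lambda(\rho,\rho')=\inf\Big\{\lambda_1\lambda_2 : \lambda_1,\lambda_2>0,\ \exists A\ge 0,\ \tfrac1{\lambda_1}d'-A\le d\le\lambda_2 d'+A\Big\},\qquad \Delta(\rho,\rho')=\log\Lambda(\rho,\rho'),$$ which do not depend on the representatives. For $d,d'\in\mathcal D(G)$ and $x\in G$ let $\ell_d(x)=\lim_{n\to\infty}d(x^n,1)/n$ and let $$\mathrm{Dil}(d,d')=\sup_x \frac{\ell_d(x)}{\ell_{d'}(x)},$$ where $x$ runs over the elements of infinite order of $G$. (1) For all $\rho,\rho'\in\mathscr D(G)$ and all $d\in\rho$, $d'\in\rho'$, the sets whose infimum and supremum define $\Lambda(\rho,\rho')$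 and $\mathrm{Dil}(d,d')$ are non-empty, the second one is bounded above, and $$\Lambda(\rho,\rho')=\mathrm{Dil}(d,d')\,\mathrm{Dil}(d',d).$$ (2) Let $\mathscr T(G)$ be the Teichmüller space of $G$: the set of isometric actions $\varphi$ of $G$ on the hyperbolic plane $\mathbb H^2$ that are free, properly discontinuous and cocompact, up to conjugation by isometries of $\mathbb H^2$. (It is the space of marked hyperbolic structures on a closed surface with fundamental group $G$, and is empty if $G$ is not the fundamental group of a closed surface.) For $X=[\varphi]\in\mathscr T(G)$ and $g\in G$ let $L_X(g)=\inf_{z\in\mathbb H^2}d_{\mathbb H^2}(z,\varphi(g)z)$, and let $d_{\mathrm{Th}}(X,Y)=\log\sup_{g\ne1}L_Y(g)/L_X(g)$ be Thurston's asymmetric metric. Then for every such $\varphi$ and every $o\in\mathbb H^2$ the pseudometric $d_{\varphi,o}(x,y)=d_{\mathbb H^2}(\varphi(x)o,\varphi(y)o)$ lies in $\mathcal D(G)$, the class $\iota([\varphi])=[d_{\varphi,o}]$ depends only on $[\varphi]\in\mathscr T(G)$, the suprema defining $d_{\mathrm{Th}}$ are finite, and for all $X,Y\in\mathscr T(G)$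 $$\Delta(\iota(X),\iota(Y))=2\cdot\tfrac12\big(d_{\mathrm{Th}}(X,Y)+d_{\mathrm{Th}}(Y,X)\big),$$ that is, $\Delta$ restricts on $\mathscr T(G)$ to twice the symmetrized Thurston metric. -/

import Mathlib

open Filter Topology

noncomputable section

namespace HypGroup

/-! ## Pseudometrics, hyperbolicity, word metrics -/

/-- `d` is a pseudometric on the set `X` (nonnegativity follows from these axioms). -/
structure IsPseudometric {X : Type*} (d : X → X → ℝ) : Prop where
  self : ∀ x, d x x = 0
  symm : ∀ x y, d x y = d y x
  triangle : ∀ x y z, d x z ≤ d x y + d y z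

/-- The Gromov product of `x` and `y` based at `w`. -/
def gromovProduct {X : Type*} (d : X → X → ℝ) (x y w : X) : ℝ :=
  (d x w + d y w - d x y) / 2

/-- Gromov hyperbolicity: the four-point inequality for some constant `δ ≥ 0`. -/
def IsGromovHyperbolic {X : Type*} (d : X → X → ℝ) : Prop :=
  ∃ δ : ℝ, 0 ≤ δ ∧ ∀ x y z w : X,
    min (gromovProduct d x y w) (gromovProduct d y z w) - δ ≤ gromovProduct d x z w

variable {G : Type*} [Group G]

/-- Invariance under left translations. -/
def IsLeftInvariant (d : G → G → ℝ) : Prop :=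
  ∀ g x y : G, d (g * x) (g * y) = d x y

/-- Word length of `g` with respect to `S ∪ S⁻¹`
(only used when `S` generates `G`, so that the set below is nonempty). -/
def wordLength (S : Finset G) (g : G) : ℕ :=
  sInf {n : ℕ | ∃ l : List G, l.length = n ∧ (∀ a ∈ l, a ∈ S ∨ a⁻¹ ∈ S) ∧ l.prod = g}

/-- The (left-invariant) word metric of the symmetric set `S ∪ S⁻¹`. -/
def wordMetric (S : Finset G) (x y : G) : ℝ := (wordLength S (x⁻¹ * y) : ℝ)

/-- Two pseudometrics on the same set are quasi-isometric (through the identity map). -/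
def AreQuasiIsometric {X : Type*} (d₁ d₂ : X → X → ℝ) : Prop :=
  ∃ l₁ l₂ ε : ℝ, 0 < l₁ ∧ 0 < l₂ ∧ 0 ≤ ε ∧
    ∀ x y, 1 / l₁ * d₁ x y - ε ≤ d₂ x y ∧ d₂ x y ≤ l₂ * d₁ x y + ε

/-- `G` is a hyperbolic group: it has a finite generating set with hyperbolic word metric. -/
def IsHyperbolicGroup (G : Type*) [Group G] : Prop :=
  ∃ S : Finset G, Subgroup.closure (S : Set G) = ⊤ ∧ IsGromovHyperbolic (wordMetric S)

/-- `G` has an abelian subgroup of finite index. A hyperbolic group is non-elementary when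
this fails. -/
def IsVirtuallyAbelian (G : Type*) [Group G] : Prop :=
  ∃ H : Subgroup G, H.FiniteIndex ∧ ∀ a ∈ H, ∀ b ∈ H, a * b = b * a

/-! ## The space of metric structures -/

/-- The set of hyperbolic, left-invariant pseudometrics on `G` that are quasi-isometric to the
word metric of some finite generating set. -/
def hypPseudometrics (G : Type*) [Group G] : Set (G → G → ℝ) :=
  {d | IsPseudometric d ∧ IsGromovHyperbolic d ∧ IsLeftInvariant d ∧
    ∃ S : Finset G, Subgroup.closure (S : Set G) = ⊤ ∧ AreQuasiIsometric d (wordMetric S)}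

/-- Rough similarity of pseudometrics. -/
def RoughlySimilar {X : Type*} (d d' : X → X → ℝ) : Prop :=
  ∃ k A : ℝ, 0 < k ∧ 0 < A ∧ ∀ x y, |d x y - k * d' x y| ≤ A

theorem RoughlySimilar.refl {X : Type*} (d : X → X → ℝ) : RoughlySimilar d d :=
  ⟨1, 1, one_pos, one_pos, fun x y => by simp⟩

theorem RoughlySimilar.symm {X : Type*} {d d' : X → X → ℝ} (h : RoughlySimilar d d') :
    RoughlySimilar d' d := by
  obtain ⟨k, A, hk, hA, h⟩ := h
  refine ⟨k⁻¹, k⁻¹ * A, by positivity, by positivity, fun x y => ?_⟩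
  have e : d' x y - k⁻¹ * d x y = -(k⁻¹ * (d x y - k * d' x y)) := by field_simp; ring
  rw [e, abs_neg, abs_mul, abs_of_pos (inv_pos.2 hk)]
  exact mul_le_mul_of_nonneg_left (h x y) (by positivity)

theorem RoughlySimilar.trans {X : Type*} {d d' d'' : X → X → ℝ} (h : RoughlySimilar d d')
    (h' : RoughlySimilar d' d'') : RoughlySimilar d d'' := by
  obtain ⟨k, A, hk, hA, h⟩ := h
  obtain ⟨k', A', hk', hA', h'⟩ := h'
  refine ⟨k * k', A + k * A', by positivity, by positivity, fun x y => ?_⟩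
  have e : d x y - k * k' * d'' x y = (d x y - k * d' x y) + k * (d' x y - k' * d'' x y) := by
    ring
  rw [e]
  refine (abs_add_le _ _).trans (add_le_add (h x y) ?_)
  rw [abs_mul, abs_of_pos hk]
  exact mul_le_mul_of_nonneg_left (h' x y) hk.le

instance roughSimilaritySetoid (G : Type*) [Group G] : Setoid (hypPseudometrics G) where
  r d d' := RoughlySimilar d.1 d'.1
  iseqv := ⟨fun d => RoughlySimilar.refl d.1, RoughlySimilar.symm, RoughlySimilar.trans⟩

/-- The space of metric structures on `G`: rough similarity classes. -/
def MetricStructure (G : Type*) [Group G] : Type _ := Quotient (roughSimilaritySetoid G)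

/-- The metric structure `[d]` of a pseudometric `d`. -/
def metricStructureOf (d : hypPseudometrics G) : MetricStructure G :=
  Quotient.mk (roughSimilaritySetoid G) d

/-- The products `l₁ l₂` such that `d₂ / l₁ - A ≤ d₁ ≤ l₂ d₂ + A` for some `A ≥ 0`. -/
def qiConstants {X : Type*} (d₁ d₂ : X → X → ℝ) : Set ℝ :=
  {r | ∃ l₁ l₂ : ℝ, 0 < l₁ ∧ 0 < l₂ ∧ r = l₁ * l₂ ∧ ∃ A : ℝ, 0 ≤ A ∧
    ∀ x y, 1 / l₁ * d₂ x y - A ≤ d₁ x y ∧ d₁ x y ≤ l₂ * d₂ x y + A}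

theorem qiConstants_symm_subset {X : Type*} (d₁ d₂ : X → X → ℝ) :
    qiConstants d₁ d₂ ⊆ qiConstants d₂ d₁ := by
  rintro r ⟨l₁, l₂, h₁, h₂, rfl, A, hA, h⟩
  refine ⟨l₂, l₁, h₂, h₁, mul_comm _ _, l₁ * A + A / l₂, by positivity, fun x y => ?_⟩
  obtain ⟨ha, hb⟩ := h x y
  constructor
  · have e : d₁ x y / l₂ ≤ d₂ x y + A / l₂ := by
      rw [div_le_iff₀ h₂, add_mul, div_mul_cancel₀ _ h₂.ne']; linarith
    have : 0 ≤ l₁ * A := by positivity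
    rw [one_div, inv_mul_eq_div]; linarith
  · have e : d₂ x y = l₁ * (1 / l₁ * d₂ x y) := by field_simp
    have : 0 ≤ A / l₂ := by positivity
    nlinarith

theorem qiConstants_symm {X : Type*} (d₁ d₂ : X → X → ℝ) :
    qiConstants d₁ d₂ = qiConstants d₂ d₁ :=
  Set.Subset.antisymm (qiConstants_symm_subset _ _) (qiConstants_symm_subset _ _)

theorem qiConstants_subset {X : Type*} {d d' e : X → X → ℝ} (h : RoughlySimilar d d') :
    qiConstants d' e ⊆ qiConstants d e := by
  obtain ⟨k, B, hk, hB, h⟩ := h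
  rintro r ⟨l₁, l₂, h₁, h₂, rfl, A, hA, h'⟩
  refine ⟨l₁ / k, k * l₂, by positivity, by positivity, by field_simp, k * A + B,
    by positivity, fun x y => ?_⟩
  obtain ⟨ha, hb⟩ := h' x y
  obtain ⟨hc, hd⟩ := abs_le.1 (h x y)
  have e1 : 1 / (l₁ / k) * e x y = k * (1 / l₁ * e x y) := by field_simp
  rw [e1]
  have i1 := mul_le_mul_of_nonneg_left ha hk.le
  have i2 := mul_le_mul_of_nonneg_left hb hk.le
  constructor <;> nlinarith

theorem qiConstants_congr {X : Type*} {d₁ d₂ e₁ e₂ : X → X → ℝ} (h₁ : RoughlySimilar d₁ e₁)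
    (h₂ : RoughlySimilar d₂ e₂) : qiConstants d₁ d₂ = qiConstants e₁ e₂ := by
  have key : ∀ {a b c : X → X → ℝ}, RoughlySimilar a b → qiConstants a c = qiConstants b c :=
    fun h => Set.Subset.antisymm (qiConstants_subset h.symm) (qiConstants_subset h)
  rw [key h₁, qiConstants_symm, key h₂, qiConstants_symm]

/-- `Λ(ρ₁, ρ₂)`, the infimum of `qiConstants`; it does not depend on the representatives. -/
def Lam (ρ₁ ρ₂ : MetricStructure G) : ℝ :=
  Quotient.lift₂ (fun d₁ d₂ : hypPseudometrics G => sInf (qiConstants d₁.1 d₂.1))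
    (fun _ _ _ _ h₁ h₂ => congrArg sInf (qiConstants_congr h₁ h₂)) ρ₁ ρ₂

/-- The distance `Δ = log Λ` on the space of metric structures. -/
def Del (ρ₁ ρ₂ : MetricStructure G) : ℝ := Real.log (Lam ρ₁ ρ₂)

/-! ## Marked length spectrum and dilation -/

/-- The translation length of `x`, the limit of `d(xⁿ, 1) / n`. -/
def translationLength (d : G → G → ℝ) (x : G) : ℝ :=
  limUnder atTop (fun n : ℕ => d (x ^ n) 1 / n)

/-- For a left-invariant pseudometric, the limit defining the translation length exists. -/
theorem tendsto_translationLength {d : G → G → ℝ} (hd : IsPseudometric d)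
    (hl : IsLeftInvariant d) (x : G) :
    Tendsto (fun n : ℕ => d (x ^ n) 1 / n) atTop (𝓝 (translationLength d x)) := by
  have hsub : Subadditive (fun n : ℕ => d (x ^ n) 1) := fun m n => by
    have h1 := hd.triangle (x ^ (m + n)) (x ^ m) 1
    have h2 : d (x ^ (m + n)) (x ^ m) = d (x ^ n) 1 := by
      have := hl (x ^ m) (x ^ n) 1
      rwa [mul_one, ← pow_add] at this
    change d (x ^ (m + n)) 1 ≤ d (x ^ m) 1 + d (x ^ n) 1
    linarith
  have h0 : ∀ a b, 0 ≤ d a b := fun a b => by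
    have h1 := hd.triangle a b a
    rw [hd.self, hd.symm b a] at h1
    linarith
  have hb : BddBelow (Set.range fun n : ℕ => d (x ^ n) 1 / n) :=
    ⟨0, by rintro _ ⟨n, rfl⟩; exact div_nonneg (h0 _ _) (Nat.cast_nonneg n)⟩
  exact tendsto_nhds_limUnder ⟨_, hsub.tendsto_lim hb⟩

/-- The ratios `ℓ_d(x) / ℓ_{d'}(x)`, where `x` runs over the elements of infinite order. -/
def lengthRatios (d d' : G → G → ℝ) : Set ℝ :=
  {r | ∃ x : G, ¬ IsOfFinOrder x ∧ r = translationLength d x / translationLength d' x}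

/-- The dilation `Dil(d, d')`. -/
def Dil (d d' : G → G → ℝ) : ℝ := sSup (lengthRatios d d')

/-! ## Teichmüller space and the Thurston metric -/

/-- `φ` is an isometric action of `G` on the hyperbolic plane that is free, properly
discontinuous and cocompact. Equivalently, the plane modulo `G` is a closed hyperbolic surface
with fundamental group identified with `G` by `φ`. -/
structure IsSurfaceAction (φ : G →* (UpperHalfPlane ≃ᵢ UpperHalfPlane)) : Prop where
  free : ∀ g : G, g ≠ 1 → ∀ z, φ g z ≠ z
  properlyDiscontinuous : ∀ K : Set UpperHalfPlane, IsCompact K →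
    {g : G | (φ g '' K ∩ K).Nonempty}.Finite
  cocompact : ∃ K : Set UpperHalfPlane, IsCompact K ∧ ⋃ g : G, φ g '' K = Set.univ

/-- Marked closed hyperbolic surfaces with fundamental group `G`. -/
def SurfaceAction (G : Type*) [Group G] : Type _ :=
  {φ : G →* (UpperHalfPlane ≃ᵢ UpperHalfPlane) // IsSurfaceAction φ}

/-- Conjugacy by an isometry of the hyperbolic plane. -/
instance conjugacySetoid (G : Type*) [Group G] : Setoid (SurfaceAction G) where
  r φ ψ := ∃ f : UpperHalfPlane ≃ᵢ UpperHalfPlane, ∀ g, ψ.1 g = f * φ.1 g * f⁻¹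
  iseqv :=
    { refl := fun φ => ⟨1, fun g => by simp⟩
      symm := fun {φ ψ} ⟨f, hf⟩ => ⟨f⁻¹, fun g => by rw [hf]; group⟩
      trans := fun {φ ψ χ} ⟨f, hf⟩ ⟨f', hf'⟩ => ⟨f' * f, fun g => by rw [hf', hf]; group⟩ }

/-- The Teichmüller space of the closed surface with fundamental group `G`. -/
def TeichmullerSpace (G : Type*) [Group G] : Type _ := Quotient (conjugacySetoid G)

/-- The point of Teichmüller space of a marked hyperbolic surface. -/
def teichmullerPoint (φ : SurfaceAction G) : TeichmullerSpace G :=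
  Quotient.mk (conjugacySetoid G) φ

/-- The length of the closed geodesic in the free homotopy class of `g` on the hyperbolic
surface `X`, as the minimal displacement of `g` on the hyperbolic plane. -/
def geodesicLength (X : TeichmullerSpace G) (g : G) : ℝ :=
  Quotient.lift (fun φ : SurfaceAction G => ⨅ z : UpperHalfPlane, dist z (φ.1 g z))
    (by
      rintro φ ψ ⟨f, hf⟩
      refine Equiv.iInf_congr f.toEquiv fun z => ?_
      have e : ψ.1 g (f z) = f (φ.1 g z) := by
        rw [hf]
        exact congrArg (fun w => f (φ.1 g w)) (f.symm_apply_apply z)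
      change dist (f z) (ψ.1 g (f z)) = _
      rw [e, f.dist_eq]) X

/-- The ratios of the lengths on `Y` and on `X` of the nontrivial closed curves. -/
def geodesicLengthRatios (X Y : TeichmullerSpace G) : Set ℝ :=
  {r | ∃ g : G, g ≠ 1 ∧ r = geodesicLength Y g / geodesicLength X g}

/-- Thurston's asymmetric distance from `X` to `Y`: the logarithm of the best upper bound for
the stretching of lengths of closed curves. -/
def thurstonDist (X Y : TeichmullerSpace G) : ℝ := Real.log (sSup (geodesicLengthRatios X Y))

/-- The symmetrized Thurston metric. -/
def symThurstonDist (X Y : TeichmullerSpace G) : ℝ := (thurstonDist X Y + thurstonDist Y X) / 2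

/-- The pseudometric on `G` induced by the orbit of `o` under the action `φ`. -/
def orbitPseudometric (φ : SurfaceAction G) (o : UpperHalfPlane) (x y : G) : ℝ :=
  dist (φ.1 x o) (φ.1 y o)

end HypGroup

end

open HypGroup

/-!
The inequality `Dil d d' * Dil d' d ≤ Λ` is immediate: an estimate `d ≤ l * d' + A` passes to
translation lengths. For the converse it suffices that `d ≤ Dil d d' * d' + A` for some `A`. This
follows once every `g : G` has a multiple `g * f`, with `f` in a fixed finite set, such that
`translationLength d (g * f) ≥ d 1 g - C` (`exists_finset_le_translationLength`), because then
`d 1 g ≤ translationLength d (g * f) + C ≤ Dil d d' * translationLength d' (g * f) + C`, and the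
last translation length is at most `d' 1 g` up to a constant.

In a hyperbolic pseudometric, `d 1 (h ^ 2) - d 1 h` bounds the translation length of `h` from
below up to a constant (`FourPoint.sub_le_translationLength`), so that `h = g * f` works as soon as
`h` and `h⁻¹` point in different directions seen from `1`. If no finite set of factors `f` achieved
this for all `g`, there would be a direction at infinity fixed by the whole group. Its Busemann
function is a quasimorphism, with finite level sets because conjugation by points far out in the
fixed direction maps a level set into a ball of fixed radius; hence `G` would be virtually cyclic
(`isVirtuallyAbelian_of_fixed_direction`). Here points lying nearly on a geodesic are needed,
although `d` is not assumed to be geodesic: they exist since `d` is quasi-isometric to a word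
metric, by the argument for the stability of quasi-geodesics (`FourPoint.isRoughlyGeodesic`).

For the statement on Teichmüller space, the hyperbolic plane is Gromov hyperbolic by Ptolemy's
inequality for `sinh (dist / 2)` (`fourPoint_dist_upperHalfPlane`), and orbit maps are
quasi-isometries by the Milnor–Švarc argument. The minimal displacement of an isometry `f` equals
its translation length: the midsegment of a triangle is at most half as long as the opposite side
(`dist_midpoints_le`), so the midpoint of `z` and `f z` is moved by `f` at most half as far as `z`
is moved by `f ^ 2`. Therefore Thurston's asymmetric metric is the logarithm of a dilation, and the
first part gives the result.
-/

namespace HypGroup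

/-! ### The four-point condition -/

/-- The four-point form of `δ`-hyperbolicity: among the three sums of distances of opposite pairs
of four points, the largest two differ by at most `2δ`. -/
def FourPoint {X : Type*} (d : X → X → ℝ) (δ : ℝ) : Prop :=
  ∀ x y z w, d x z + d y w ≤ max (d x y + d z w) (d x w + d y z) + 2 * δ

section Pseudometric

variable {X : Type*} {d : X → X → ℝ} {δ : ℝ}

theorem IsPseudometric.nonneg (hd : IsPseudometric d) (x y : X) : 0 ≤ d x y := by
  have h := hd.triangle x y x
  rw [hd.self, hd.symm y x] at h
  linarith

theorem IsGromovHyperbolic.exists_fourPoint (h : IsGromovHyperbolic d) :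
    ∃ δ, 0 ≤ δ ∧ FourPoint d δ := by
  obtain ⟨δ, hδ, h⟩ := h
  refine ⟨δ, hδ, fun x y z w => ?_⟩
  have := h x y z w
  simp only [gromovProduct] at this
  rcases min_cases ((d x w + d y w - d x y) / 2) ((d y w + d z w - d y z) / 2) with h1 | h1
  · have := le_max_left (d x y + d z w) (d x w + d y z)
    linarith
  · have := le_max_right (d x y + d z w) (d x w + d y z)
    linarith

theorem FourPoint.isGromovHyperbolic (hδ : 0 ≤ δ) (h : FourPoint d δ) :
    IsGromovHyperbolic d := by
  refine ⟨δ, hδ, fun x y z w => ?_⟩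
  have := h x y z w
  simp only [gromovProduct]
  rcases max_cases (d x y + d z w) (d x w + d y z) with h1 | h1
  · have := min_le_left ((d x w + d y w - d x y) / 2) ((d y w + d z w - d y z) / 2)
    linarith
  · have := min_le_right ((d x w + d y w - d x y) / 2) ((d y w + d z w - d y z) / 2)
    linarith

theorem gromovProduct_comm (hd : IsPseudometric d) (x y w : X) :
    gromovProduct d x y w = gromovProduct d y x w := by
  simp only [gromovProduct, hd.symm x y]; ring

/-- The difference of the distances to `1` and to `b` depends, up to `2δ`, only on the direction
of the far away point from which they are measured. -/
theorem FourPoint.busemann_le (hd : IsPseudometric d) (h : FourPoint d δ) {b o u v : X}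
    (hb : d o b ≤ gromovProduct d u v o) : d b u + d o v ≤ d b v + d o u + 2 * δ := by
  have h1 := h b o u v
  have h2 := hd.triangle o b v
  simp only [gromovProduct] at hb
  rw [hd.symm u o, hd.symm v o] at hb
  rw [hd.symm b o] at h1
  rwa [max_eq_right (by linarith)] at h1

/-! ### Rough geodesicity -/

/-- Any two points are joined by a chain with uniformly bounded steps whose number is bounded
linearly in their distance. -/
def HasLinearChains (d : X → X → ℝ) : Prop :=
  ∃ c L : ℝ, 0 ≤ c ∧ 0 ≤ L ∧ ∀ x y, ∃ (n : ℕ) (u : ℕ → X), u 0 = x ∧ u n = y ∧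
    (∀ i < n, d (u i) (u (i + 1)) ≤ c) ∧ (n : ℝ) ≤ L * d x y + L

/-- Any two points are joined by a geodesic up to a uniform additive error `D`. Only the points of
such a geodesic are recorded: for each `t` a point at distance about `t` from one end and about
`d x y - t` from the other. -/
def IsRoughlyGeodesic (d : X → X → ℝ) : Prop :=
  ∃ D : ℝ, 0 ≤ D ∧ ∀ x y t, 0 ≤ t → t ≤ d x y →
    ∃ p, d x p ≤ t + D ∧ d p y ≤ d x y - t + D

/-- Along a chain, a Gromov product only decays logarithmically in the length of the chain. -/
theorem le_product_of_chain {P : X → X → ℝ} (hδ : 0 ≤ δ)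
    (hP : ∀ x y z, min (P x y) (P y z) - δ ≤ P x z) {c : ℝ} (hself : ∀ x, c ≤ P x x) (k : ℕ) :
    ∀ (n : ℕ) (u : ℕ → X), n ≤ 2 ^ k → (∀ i < n, c ≤ P (u i) (u (i + 1))) →
      c - k * δ ≤ P (u 0) (u n) := by
  induction k with
  | zero =>
    intro n u hn hu
    obtain rfl | rfl : n = 0 ∨ n = 1 := by simp at hn; omega
    · simpa using hself (u 0)
    · simpa using hu 0 one_pos
  | succ k ih =>
    intro n u hn hu
    push_cast
    rcases le_total n (2 ^ k) with h | h
    · have := ih n u h hu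
      linarith
    · have h1 := ih (2 ^ k) u le_rfl fun i hi => hu i (hi.trans_le h)
      have h2 := ih (n - 2 ^ k) (fun i => u (2 ^ k + i)) (by rw [pow_succ] at hn; omega)
        fun i hi => hu _ (by omega)
      simp only [add_zero, Nat.add_sub_cancel' h] at h2
      have h3 := hP (u 0) (u (2 ^ k)) (u n)
      have := le_min h1 h2
      linarith

theorem eventually_mul_add_le_two_pow (A B : ℝ) : ∀ᶠ k : ℕ in atTop, A * k + B ≤ 2 ^ k := by
  have h1 := tendsto_pow_const_div_const_pow_of_one_lt 1 (one_lt_two (α := ℝ))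
  have h2 := tendsto_pow_const_div_const_pow_of_one_lt 0 (one_lt_two (α := ℝ))
  have h := (h1.const_mul A).add (h2.const_mul B)
  simp only [mul_zero, add_zero, pow_one, pow_zero] at h
  filter_upwards [h.eventually (eventually_le_nhds one_pos)] with k hk
  have : (0 : ℝ) < 2 ^ k := by positivity
  have e : A * k + B = (A * (k / 2 ^ k) + B * (1 / 2 ^ k)) * 2 ^ k := by field_simp
  rw [e]
  nlinarith

/-- A hyperbolic pseudometric with linear chains is roughly geodesic. The function
`f t x = max (d a x - t) (d x b - (d a b - t))` plays the role of the distance of `x` to the point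
at distance `t` from `a` on an ideal geodesic from `a` to `b`. If this point is far from every
point of `X`, then a chain joining a point near the ideal geodesic before it to one after it is
too short to bypass it, by `le_product_of_chain`. -/
theorem FourPoint.isRoughlyGeodesic (hd : IsPseudometric d) (hδ : 0 ≤ δ) (h : FourPoint d δ)
    (hc : HasLinearChains d) : IsRoughlyGeodesic d := by
  obtain ⟨c, L, hc0, hL, hc⟩ := hc
  set M : ℝ := δ + 1 with hM
  -- the scale `M * k` at which the exponential `2 ^ k` beats the length of the bypassing chains
  have hk0 : ∃ k₀ : ℕ, ∀ k ≥ k₀, L * (6 * M * (k + 1) + 2 * δ) + L ≤ 2 ^ k ∧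
      c / 2 + (k + 2) * δ < M * k := by
    have h1 := eventually_mul_add_le_two_pow (L * 6 * M) (L * (6 * M + 2 * δ) + L)
    have h2 : ∀ᶠ k : ℕ in atTop, c / 2 + 2 * δ + 1 ≤ (k : ℝ) :=
      tendsto_natCast_atTop_atTop.eventually_ge_atTop _
    obtain ⟨k₀, hk₀⟩ := eventually_atTop.1 (h1.and h2)
    refine ⟨k₀, fun k hk => ?_⟩
    obtain ⟨h3, h4⟩ := hk₀ k hk
    constructor
    · linarith
    · rw [hM]; linarith
  obtain ⟨k₀, hk₀⟩ := hk0
  have hM0 : 0 < M := by linarith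
  refine ⟨M * k₀, by positivity, fun a b => ?_⟩
  set T := d a b with hT
  set f : ℝ → X → ℝ := fun t x => max (d a x - t) (d x b - (T - t)) with hf
  suffices H : ∀ t, 0 ≤ t → t ≤ T → ∃ x, f t x ≤ M * k₀ by
    intro t h0 h1
    obtain ⟨x, hx⟩ := H t h0 h1
    have h2 := (le_max_left _ _).trans hx
    have h3 := (le_max_right _ _).trans hx
    exact ⟨x, by linarith, by linarith⟩
  have step : ∀ k ≥ k₀, (∀ t, 0 ≤ t → t ≤ T → ∃ x, f t x ≤ M * (k + 1 : ℕ)) →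
      ∀ t, 0 ≤ t → t ≤ T → ∃ x, f t x ≤ M * k := by
    intro k hk hs t ht0 htT
    obtain ⟨hk1, hk2⟩ := hk₀ k hk
    by_contra! hfar
    have fl : ∀ s x, d a x - s ≤ f s x := fun s x => le_max_left _ _
    have fr : ∀ s x, d x b - (T - s) ≤ f s x := fun s x => le_max_right _ _
    push_cast at hs
    set N : ℝ := M * (k + 1) with hN
    have hN0 : 0 ≤ N := by positivity
    -- Gromov products based at the ideal point
    set P : X → X → ℝ := fun x y => (f t x + f t y - d x y) / 2 with hPdef
    have hP : ∀ x y z, min (P x y) (P y z) - δ ≤ P x z := by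
      intro x y z
      have key : d x z + f t y ≤ max (d x y + f t z) (f t x + d y z) + 2 * δ := by
        have h1 := h x y z a
        have h2 := h x y z b
        rw [hd.symm x a, hd.symm y a, hd.symm z a] at h1
        have m1 := max_le_max (add_le_add_right (fl t z) (d x y)) (add_le_add_left (fl t x) (d y z))
        have m2 := max_le_max (add_le_add_right (fr t z) (d x y)) (add_le_add_left (fr t x) (d y z))
        have e1 : ∀ p q r s e : ℝ, max (p + (q - e)) (r - e + s) = max (p + q) (r + s) - e := by
          intro p q r s e
          rw [← max_sub_sub_right]; congr 1 <;> ring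
        rw [e1] at m1 m2
        rcases max_cases (d a y - t) (d y b - (T - t)) with h3 | h3
        · have : f t y = d a y - t := h3.1
          linarith
        · have : f t y = d y b - (T - t) := h3.1
          linarith
      simp only [hPdef]
      rcases max_cases (d x y + f t z) (f t x + d y z) with h1 | h1
      · have := min_le_left ((f t x + f t y - d x y) / 2) ((f t y + f t z - d y z) / 2)
        linarith
      · have := min_le_right ((f t x + f t y - d x y) / 2) ((f t y + f t z - d y z) / 2)
        linarith
    have hself : ∀ x, M * k - c / 2 ≤ P x x := fun x => by
      have := hfar x
      simp only [hPdef, hd.self]; linarith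
    have hfa : f t a = t := by
      simp only [hf, hd.self]
      rw [← hT]; ring_nf
      exact max_eq_right (by linarith)
    have hfb : f t b = T - t := by
      simp only [hf, hd.self]
      rw [← hT]
      exact max_eq_left (by linarith)
    -- points near the ideal geodesic at distance `2 * N` before and after the ideal point
    have hxa : ∃ x, M * k ≤ P a x ∧ f t x ≤ 3 * N := by
      have ha := hfar a
      rcases le_total t (2 * N) with h1 | h1
      · exact ⟨a, by simp only [hPdef, hd.self]; linarith, by linarith⟩
      · obtain ⟨x, hx⟩ := hs (t - 2 * N) (by linarith) (by linarith)
        have h2 := fl (t - 2 * N) x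
        have h3 := fr (t - 2 * N) x
        have h4 := hfar x
        refine ⟨x, ?_, max_le (by linarith) (by linarith)⟩
        simp only [hPdef]; linarith
    have hxb : ∃ x, M * k ≤ P x b ∧ f t x ≤ 3 * N := by
      have hb := hfar b
      rcases le_total (T - t) (2 * N) with h1 | h1
      · exact ⟨b, by simp only [hPdef, hd.self]; linarith, by linarith⟩
      · obtain ⟨x, hx⟩ := hs (t + 2 * N) (by linarith) (by linarith)
        have h2 := fl (t + 2 * N) x
        have h3 := fr (t + 2 * N) x
        have h4 := hfar x
        refine ⟨x, ?_, max_le (by linarith) (by linarith)⟩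
        simp only [hPdef]; linarith
    obtain ⟨p, hp, hp'⟩ := hxa
    obtain ⟨q, hq, hq'⟩ := hxb
    have hpq : d p q ≤ 6 * N + 2 * δ := by
      have h1 := h p a q b
      have h2 := fl t p
      have h3 := fl t q
      have h4 := fr t p
      have h5 := fr t q
      rw [hd.symm p a] at h1
      have h6 : max (d a p + d q b) (d p b + d a q) ≤ T + f t p + f t q :=
        max_le (by linarith) (by linarith)
      linarith
    obtain ⟨n, u, hu0, hun, hu, hn⟩ := hc p q
    have hn' : n ≤ 2 ^ k := by
      have : L * d p q ≤ L * (6 * N + 2 * δ) := mul_le_mul_of_nonneg_left hpq hL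
      have : (n : ℝ) ≤ 2 ^ k := by rw [hN] at this; linarith
      exact_mod_cast this
    have h1 := le_product_of_chain hδ hP hself k n u hn' fun i hi => by
      have h1 := hfar (u i)
      have h2 := hfar (u (i + 1))
      have h3 := hu i hi
      simp only [hPdef]; linarith
    rw [hu0, hun] at h1
    have h2 := hP a p q
    have h3 := hP a q b
    have h4 : P a b = 0 := by
      simp only [hPdef, hfa, hfb]
      rw [← hT]; ring
    have hkδ : 0 ≤ (k : ℝ) * δ := by positivity
    have h5 : M * k - c / 2 - k * δ ≤ min (P a p) (P p q) := le_min (by linarith) h1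
    have h6 : M * k - c / 2 - k * δ - δ ≤ min (P a q) (P q b) := le_min (by linarith) (by linarith)
    linarith
  obtain ⟨m, hm⟩ := exists_nat_ge (T / M)
  have base : ∀ t, 0 ≤ t → t ≤ T → ∃ x, f t x ≤ M * (k₀ + m : ℕ) := by
    intro t ht0 htT
    refine ⟨a, max_le ?_ ?_⟩
    · have : 0 ≤ M * ((k₀ + m : ℕ) : ℝ) := by positivity
      rw [hd.self]; linarith
    · rw [div_le_iff₀ hM0] at hm
      have : 0 ≤ M * (k₀ : ℝ) := by positivity
      push_cast
      linarith
  clear hm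
  induction m with
  | zero => exact base
  | succ m ih => exact ih (step (k₀ + m) (by omega) base)

end Pseudometric

/-! ### Translation lengths -/

section Group

variable {G : Type*} [Group G] {d : G → G → ℝ} {δ : ℝ}

theorem IsLeftInvariant.dist_one_inv_mul (hl : IsLeftInvariant d) (x y : G) :
    d 1 (x⁻¹ * y) = d x y := by
  simpa using (hl x 1 (x⁻¹ * y)).symm

theorem translationLength_nonneg (hd : IsPseudometric d) (hl : IsLeftInvariant d) (x : G) :
    0 ≤ translationLength d x :=
  ge_of_tendsto' (tendsto_translationLength hd hl x) fun n =>
    div_nonneg (hd.nonneg _ _) n.cast_nonneg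

theorem dist_pow_le (hd : IsPseudometric d) (hl : IsLeftInvariant d) (x : G) (n : ℕ) :
    d (x ^ n) 1 ≤ n * d x 1 := by
  induction n with
  | zero => simp [hd.self]
  | succ n ih =>
    have h1 := hd.triangle (x ^ (n + 1)) (x ^ n) 1
    have h2 := hl (x ^ n) x 1
    rw [mul_one, ← pow_succ] at h2
    push_cast
    linarith

theorem translationLength_le (hd : IsPseudometric d) (hl : IsLeftInvariant d) (x : G) :
    translationLength d x ≤ d x 1 := by
  refine le_of_tendsto (tendsto_translationLength hd hl x) ?_
  filter_upwards [eventually_gt_atTop 0] with n hn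
  have : (0 : ℝ) < n := by exact_mod_cast hn
  rw [div_le_iff₀ this, mul_comm]
  exact dist_pow_le hd hl x n

theorem translationLength_le_mul {d' : G → G → ℝ} (hd : IsPseudometric d)
    (hl : IsLeftInvariant d) (hd' : IsPseudometric d') (hl' : IsLeftInvariant d') {L A : ℝ}
    (h : ∀ x y, d x y ≤ L * d' x y + A) (x : G) :
    translationLength d x ≤ L * translationLength d' x := by
  have h1 : Tendsto (fun n : ℕ => L * (d' (x ^ n) 1 / n) + A / n) atTop
      (𝓝 (L * translationLength d' x + 0)) :=
    ((tendsto_translationLength hd' hl' x).const_mul L).add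
      (tendsto_const_div_atTop_nhds_zero_nat A)
  rw [add_zero] at h1
  refine le_of_tendsto_of_tendsto' (tendsto_translationLength hd hl x) h1 fun n => ?_
  have := div_le_div_of_nonneg_right (h (x ^ n) 1) n.cast_nonneg
  rwa [add_div, mul_div_assoc] at this

theorem translationLength_of_isOfFinOrder (hd : IsPseudometric d) (hl : IsLeftInvariant d) {x : G}
    (hx : IsOfFinOrder x) : translationLength d x = 0 := by
  obtain ⟨C, hC⟩ : ∃ C, ∀ n : ℕ, d (x ^ n) 1 ≤ C := by
    have : (Set.range fun n : ℕ => d (x ^ n) 1).Finite := by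
      refine (hx.finite_powers.image fun y => d y 1).subset ?_
      rintro _ ⟨n, rfl⟩
      exact ⟨x ^ n, ⟨n, rfl⟩, rfl⟩
    obtain ⟨C, hC⟩ := this.bddAbove
    exact ⟨C, fun n => hC ⟨n, rfl⟩⟩
  refine tendsto_nhds_unique (tendsto_translationLength hd hl x)
    (squeeze_zero (fun n => div_nonneg (hd.nonneg _ _) n.cast_nonneg)
      (fun n => div_le_div_of_nonneg_right (hC n) n.cast_nonneg)
      (tendsto_const_div_atTop_nhds_zero_nat C))

/-- If `h²` moves the base point substantially farther than `h`, then so do all higher powers: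
with `a n = d 1 (h ^ n)`, the four points `1, h, h², h ^ (n + 2)` give
`a 2 + a (n + 1) ≤ a 1 + max (a n) (a (n + 2)) + 2δ`. -/
theorem FourPoint.sub_le_translationLength (hd : IsPseudometric d) (hl : IsLeftInvariant d)
    (hδ : 0 ≤ δ) (h : FourPoint d δ) (g : G) :
    d 1 (g ^ 2) - d 1 g - 2 * δ ≤ translationLength d g := by
  set s := d 1 (g ^ 2) - d 1 g - 2 * δ with hs
  rcases le_or_gt s 0 with hs0 | hs0
  · exact hs0.trans (translationLength_nonneg hd hl g)
  have e : ∀ m n : ℕ, d (g ^ m) (g ^ (m + n)) = d 1 (g ^ n) := fun m n => by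
    have := hl (g ^ m) 1 (g ^ n)
    rwa [mul_one, ← pow_add] at this
  have key : ∀ n : ℕ, d 1 (g ^ n) + s ≤ d 1 (g ^ (n + 1)) := by
    intro n
    induction n with
    | zero =>
      have h1 := hd.triangle 1 g (g ^ 2)
      have h2 := e 1 1
      simp only [pow_one, one_add_one_eq_two] at h2
      simp only [pow_zero, hd.self, zero_add, pow_one]
      linarith
    | succ n ih =>
      have h1 := h 1 g (g ^ 2) (g ^ (n + 1 + 1))
      have h2 := e 1 (n + 1)
      have h3 := e 2 n
      have h4 := e 1 1
      rw [pow_one, add_comm 1] at h2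
      rw [show 2 + n = n + 1 + 1 by ring] at h3
      simp only [pow_one, one_add_one_eq_two] at h4
      rw [h2, h3, h4] at h1
      rcases max_cases (d 1 g + d 1 (g ^ n)) (d 1 (g ^ (n + 1 + 1)) + d 1 g) with h5 | h5
      · rw [h5.1] at h1
        linarith
      · rw [h5.1] at h1
        linarith
  have key' : ∀ n : ℕ, n * s ≤ d 1 (g ^ n) := by
    intro n
    induction n with
    | zero => simp [hd.self]
    | succ n ih =>
      have := key n
      push_cast
      linarith
  refine ge_of_tendsto (tendsto_translationLength hd hl g) ?_
  filter_upwards [eventually_gt_atTop 0] with n hn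
  have : (0 : ℝ) < n := by exact_mod_cast hn
  rw [le_div_iff₀ this, mul_comm, hd.symm]
  exact key' n

end Group

/-! ### A group fixing a direction at infinity is virtually cyclic -/

section Direction

variable {G : Type*} [Group G] {d : G → G → ℝ} {δ : ℝ}

theorem isVirtuallyAbelian_of_finite [Finite G] : IsVirtuallyAbelian G := by
  refine ⟨⊥, inferInstance, fun a ha b hb => ?_⟩
  rw [Subgroup.mem_bot.1 ha, Subgroup.mem_bot.1 hb]

/-- A quasimorphism with finite level sets: each translate of a suitable cyclic subgroup meets a
fixed level set, so this subgroup has finite index. -/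
theorem isVirtuallyAbelian_of_quasimorphism (h : G → ℝ) {E : ℝ}
    (hE : ∀ a b, |h (a * b) - h a - h b| ≤ E) (hfin : ∀ K, {w | |h w| ≤ K}.Finite) :
    IsVirtuallyAbelian G := by
  by_cases hG : Finite G
  · exact isVirtuallyAbelian_of_finite
  have hinf : Infinite G := not_finite_iff_infinite.1 hG
  obtain ⟨g, hg⟩ : ∃ g, E < h g := by
    obtain ⟨g, hg⟩ := (hfin (2 * E + |h 1|)).exists_notMem
    simp only [Set.mem_ofPred_eq, not_le] at hg
    by_contra! H
    have h1 := abs_le.1 (hE g g⁻¹)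
    rw [mul_inv_cancel] at h1
    have h2 := neg_abs_le (h 1)
    have h3 := H g
    have h4 := H g⁻¹
    have h5 := abs_nonneg (h 1)
    rcases abs_cases (h g) with h6 | h6 <;> linarith
  set K := h g + E with hK
  have hE0 : 0 ≤ E := (abs_nonneg _).trans (hE 1 1)
  have descent : ∀ (m : ℕ) (x : G), |h x| ≤ m * (h g - E) + K → ∃ n : ℤ, |h (x * g ^ n)| ≤ K := by
    intro m
    induction m with
    | zero => exact fun x hx => ⟨0, by simpa using hx⟩
    | succ m ih =>
      intro x hx
      push_cast at hx
      rcases le_or_gt |h x| K with h1 | h1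
      · exact ⟨0, by simpa using h1⟩
      rcases le_total 0 (h x) with h2 | h2
      · rw [abs_of_nonneg h2] at hx h1
        have h3 := abs_le.1 (hE (x * g⁻¹) g)
        rw [inv_mul_cancel_right] at h3
        obtain ⟨n, hn⟩ := ih (x * g⁻¹) (by rw [abs_of_nonneg] <;> linarith)
        exact ⟨-1 + n, by rwa [zpow_add, zpow_neg_one, ← mul_assoc]⟩
      · rw [abs_of_nonpos h2] at hx h1
        have h3 := abs_le.1 (hE x g)
        obtain ⟨n, hn⟩ := ih (x * g) (by rw [abs_of_nonpos] <;> linarith)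
        exact ⟨1 + n, by rwa [zpow_add, zpow_one, ← mul_assoc]⟩
  refine ⟨Subgroup.zpowers g, ?_, ?_⟩
  · have hsurj : (Set.univ : Set (G ⧸ Subgroup.zpowers g)) ⊆
        (fun x : G => (x : G ⧸ Subgroup.zpowers g)) '' {w | |h w| ≤ K} := by
      intro q _
      induction q using QuotientGroup.induction_on with
      | H x =>
        obtain ⟨m, hm⟩ := exists_nat_ge (|h x| / (h g - E))
        rw [div_le_iff₀ (by linarith)] at hm
        obtain ⟨n, hn⟩ := descent m x (by linarith)
        refine ⟨x * g ^ n, hn, ?_⟩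
        exact QuotientGroup.mk_mul_of_mem x ⟨n, rfl⟩
    have : Finite (G ⧸ Subgroup.zpowers g) :=
      Set.finite_univ_iff.1 (((hfin K).image _).subset hsurj)
    exact Subgroup.finiteIndex_of_finite_quotient
  · rintro _ ⟨m, rfl⟩ _ ⟨n, rfl⟩
    exact zpow_mul_comm g m n

/-- If `v` is a far away point in a direction almost fixed by `w`, and `w` moves horospheres
centered in this direction by at most `K`, then the points `p` on the way to `v` are
moved by `w` by an amount that depends on `K` only. -/
theorem FourPoint.dist_mul_le (hd : IsPseudometric d) (hl : IsLeftInvariant d)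
    (hδ : 0 ≤ δ) (h : FourPoint d δ) {v w p : G} {D K t : ℝ}
    (hp : d 1 p ≤ t + D) (hpv : d p v ≤ d 1 v - t + D) (hwt : d 1 w + D ≤ t)
    (hvw : d 1 w + t + D ≤ gromovProduct d v (w * v) 1)
    (hK : |d w v - d 1 v| ≤ K) : d p (w * p) ≤ 2 * D + 2 * K + 8 * δ := by
  have hK := abs_le.1 hK
  rw [gromovProduct_comm hd] at hvw
  have e1 : d w (w * v) = d 1 v := by simpa using hl w 1 v
  have e2 : d w (w * p) = d 1 p := by simpa using hl w 1 p
  have e3 : d (w * p) (w * v) = d p v := hl w p v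
  have h1 := hd.nonneg 1 p
  have twp := hd.triangle 1 w (w * p)
  rw [e2] at twp
  have b1 := h.busemann_le hd (b := w) (o := 1) (u := w * v) (v := v) (by linarith)
  have b2 := h.busemann_le hd (b := w * p) (o := 1) (u := v) (v := w * v)
    (by rw [gromovProduct_comm hd]; linarith)
  have f1 := h 1 w (w * p) v
  have f2 := h p 1 (w * p) v
  rw [e1] at b1
  rw [e3] at b2
  rw [e2] at f1
  rw [hd.symm p 1] at f2
  have m1 : max (d 1 w + d (w * p) v) (d 1 v + d 1 p) ≤ d 1 v + d 1 p + K + 4 * δ :=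
    max_le (by linarith) (by linarith)
  have m2 : max (d 1 p + d (w * p) v) (d p v + d 1 (w * p)) ≤ d 1 v + 2 * D + 2 * K + 6 * δ :=
    max_le (by linarith) (by linarith)
  linarith

/-- A direction at infinity fixed by the whole group (in the sense that for all finite `F` and all
`C` some `v` has Gromov product at least `C` with all `w * v`, `w ∈ F`) only exists in virtually
abelian groups. The Busemann function of this direction is a quasimorphism. An element of a
level set of it, conjugated by points `p` on the way to the fixed direction, becomes
uniformly small, so that the level sets are finite. -/
theorem isVirtuallyAbelian_of_fixed_direction (hd : IsPseudometric d) (hl : IsLeftInvariant d)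
    (hδ : 0 ≤ δ) (h : FourPoint d δ) (hg : IsRoughlyGeodesic d)
    (hball : ∀ r, {g | d 1 g ≤ r}.Finite)
    (hfix : ∀ (F : Finset G) (C : ℝ), ∃ v, ∀ w ∈ F, C ≤ gromovProduct d v (w * v) 1) :
    IsVirtuallyAbelian G := by
  classical
  obtain ⟨D, hD, hg⟩ := hg
  obtain ⟨U, hU⟩ : ∃ U : Ultrafilter G, ∀ w C, ∀ᶠ v in U, C ≤ gromovProduct d v (w * v) 1 := by
    choose v hv using fun i : Finset G × ℕ => hfix i.1 i.2
    refine ⟨(Ultrafilter.of (atTop : Filter (Finset G × ℕ))).map v, fun w C => ?_⟩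
    obtain ⟨n, hn⟩ := exists_nat_ge C
    refine (Ultrafilter.of_le _) (?_ : ∀ᶠ i in atTop, C ≤ gromovProduct d (v i) (w * v i) 1)
    filter_upwards [eventually_ge_atTop (({w} : Finset G), n)] with i hi
    have h1 : (n : ℝ) ≤ i.2 := by exact_mod_cast hi.2
    exact (hn.trans h1).trans (hv i w (hi.1 (Finset.mem_singleton_self w)))
  have hlim : ∀ w, ∃ r, Tendsto (fun v => d w v - d 1 v) U (𝓝 r) := by
    intro w
    have hb : ∀ᶠ v in U, d w v - d 1 v ∈ Set.Icc (-d 1 w) (d 1 w) := by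
      refine Eventually.of_forall fun v => ⟨?_, ?_⟩
      · have := hd.triangle 1 w v
        linarith
      · have := hd.triangle w 1 v
        rw [hd.symm w 1] at this
        linarith
    obtain ⟨r, _, hr⟩ := isCompact_Icc.ultrafilter_le_nhds' (U.map fun v => d w v - d 1 v) hb
    exact ⟨r, hr⟩
  choose b hb using hlim
  refine isVirtuallyAbelian_of_quasimorphism b (E := 2 * δ) (fun x y => ?_) fun K => ?_
  · refine le_of_tendsto (((hb (x * y)).sub (hb x)).sub (hb y)).abs ?_
    filter_upwards [hU x⁻¹ (d 1 y)] with v hv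
    have e1 : d (x * y) v = d y (x⁻¹ * v) := by simpa using hl x y (x⁻¹ * v)
    have e2 : d x v = d 1 (x⁻¹ * v) := by simpa using hl x 1 (x⁻¹ * v)
    have b1 := h.busemann_le hd hv
    rw [gromovProduct_comm hd] at hv
    have b2 := h.busemann_le hd hv
    rw [e1, e2, abs_le]
    constructor <;> linarith
  · by_contra hinf
    set r := 2 * D + 2 * (K + 1) + 8 * δ with hr
    obtain ⟨W, hW, hcard⟩ := Set.Infinite.exists_subset_card_eq hinf ((hball r).toFinset.card + 1)
    obtain ⟨R, hR⟩ : ∃ R, ∀ w ∈ W, d 1 w ≤ R := by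
      obtain ⟨R, hR⟩ := (W.finite_toSet.image (d 1)).bddAbove
      exact ⟨R, fun w hw => hR ⟨w, hw, rfl⟩⟩
    have hev : ∀ᶠ v in U, ∀ w ∈ W, R + (R + D) + D ≤ gromovProduct d v (w * v) 1 ∧
        |d w v - d 1 v - b w| ≤ 1 := by
      rw [Filter.eventually_all_finset]
      intro w hw
      refine (hU w _).and ?_
      have := ((hb w).sub_const (b w)).abs
      rw [sub_self, abs_zero] at this
      exact this.eventually (eventually_le_nhds one_pos)
    obtain ⟨v, hv, hv'⟩ := (hev.and (hU 1 (R + D))).exists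
    have hR0 : 0 ≤ R := by
      obtain ⟨w, hw⟩ : W.Nonempty := by rw [← Finset.card_pos]; omega
      exact (hd.nonneg 1 w).trans (hR w hw)
    have hv1 : R + D ≤ d 1 v := by
      rw [one_mul] at hv'
      simpa [gromovProduct, hd.self, hd.symm v 1] using hv'
    obtain ⟨p, hp, hpv⟩ := hg 1 v (R + D) (by linarith) hv1
    have hmaps : Set.MapsTo (fun w => p⁻¹ * (w * p)) W (hball r).toFinset := by
      intro w hw
      have hw1 := hR w hw
      obtain ⟨h1, h2⟩ := hv w hw
      have h3 : |b w| ≤ K := hW hw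
      have h4 : |d w v - d 1 v| ≤ K + 1 := by
        rw [abs_le] at h2 h3 ⊢
        constructor <;> linarith
      simp only [Set.Finite.coe_toFinset, Set.mem_ofPred_eq]
      rw [hl.dist_one_inv_mul]
      exact h.dist_mul_le hd hl hδ hp hpv (by linarith) (by linarith) h4
    have hinj : Set.InjOn (fun w => p⁻¹ * (w * p)) W := fun x _ y _ hxy => by simpa using hxy
    have := Finset.card_le_card_of_injOn _ hmaps hinj
    omega

end Direction

/-! ### Translation lengths realize distances -/

section Realize

variable {G : Type*} [Group G] {d : G → G → ℝ} {δ : ℝ}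

/-- Every `g` can be multiplied by an element of a fixed finite set so that the translation length
of the product is at least the distance from `1` to `g`, up to a constant: the factor is chosen
so that `g` and `g⁻¹` get to point in different directions, and then
`FourPoint.sub_le_translationLength` applies. -/
theorem exists_finset_le_translationLength (hd : IsPseudometric d) (hl : IsLeftInvariant d)
    (hδ : 0 ≤ δ) (h : FourPoint d δ) (hg : IsRoughlyGeodesic d)
    (hball : ∀ r, {g | d 1 g ≤ r}.Finite) (hne : ¬ IsVirtuallyAbelian G) :
    ∃ (F : Finset G) (C : ℝ), ∀ g, ∃ f ∈ F, d 1 g - C ≤ translationLength d (g * f) := by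
  classical
  have hnofix : ∃ (F : Finset G) (C : ℝ), ∀ v, ∃ w ∈ F, gromovProduct d v (w * v) 1 < C := by
    by_contra! H
    exact hne (isVirtuallyAbelian_of_fixed_direction hd hl hδ h hg hball H)
  obtain ⟨F, C, hF⟩ := hnofix
  set B := ∑ w ∈ F, d 1 w with hB
  have hB0 : 0 ≤ B := Finset.sum_nonneg fun w _ => hd.nonneg 1 w
  have hinv : ∀ x, d 1 x⁻¹ = d 1 x := fun x => by
    rw [hd.symm]; simpa using (hl x x⁻¹ 1).symm
  refine ⟨insert 1 (F.image (·⁻¹)), 2 * C + 4 * δ + 6 * B, fun g => ?_⟩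
  obtain ⟨f, hf, hfB, hgf⟩ : ∃ f ∈ insert 1 (F.image (·⁻¹)), d 1 f ≤ B ∧
      gromovProduct d g (f⁻¹ * g⁻¹) 1 ≤ C + δ := by
    obtain ⟨w, hw, hwC⟩ := hF g⁻¹
    have hwB : d 1 w ≤ B := Finset.single_le_sum (fun w _ => hd.nonneg 1 w) hw
    have h1 := h g⁻¹ g (w * g⁻¹) 1
    by_cases h2 : gromovProduct d g g⁻¹ 1 ≤ C + δ
    · exact ⟨1, by simp, by rw [hd.self]; exact hB0, by simpa using h2⟩
    · refine ⟨w⁻¹, by simp [hw], by rwa [hinv], ?_⟩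
      rw [inv_inv]
      by_contra h3
      simp only [gromovProduct, hd.symm _ (1 : G)] at *
      rw [hd.symm g⁻¹ g] at h1
      have : max (d g g⁻¹ + d 1 (w * g⁻¹)) (d 1 g⁻¹ + d g (w * g⁻¹)) ≤
        d 1 g + d 1 g⁻¹ + d 1 (w * g⁻¹) - 2 * (C + δ) := max_le (by linarith) (by linarith)
      linarith
  refine ⟨f, hf, ?_⟩
  have key := h.sub_le_translationLength hd hl hδ (g * f)
  have e1 : d 1 ((g * f) ^ 2) = d (f⁻¹ * g⁻¹) (g * f) := by
    rw [← mul_inv_rev, ← hl.dist_one_inv_mul (g * f)⁻¹, inv_inv, sq]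
  have e2 : d g (g * f) = d 1 f := by simpa using hl g 1 f
  have t1 := hd.triangle 1 (g * f) g
  have t2 := hd.triangle g (g * f) (f⁻¹ * g⁻¹)
  have e3 : d 1 (f⁻¹ * g⁻¹) = d 1 (g * f) := by rw [← mul_inv_rev, hinv]
  simp only [gromovProduct, hd.symm _ (1 : G)] at hgf
  rw [hd.symm (g * f) g] at t1
  rw [hd.symm (g * f) (f⁻¹ * g⁻¹)] at t2
  linarith

end Realize

/-! ### Comparison with word metrics -/

section Word

variable {G : Type*} [Group G] {d : G → G → ℝ} {S : Finset G}

theorem exists_list_length_eq_wordLength (hS : Subgroup.closure (S : Set G) = ⊤) (g : G) :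
    ∃ l : List G, l.length = wordLength S g ∧ (∀ a ∈ l, a ∈ S ∨ a⁻¹ ∈ S) ∧ l.prod = g := by
  have hne : {n : ℕ | ∃ l : List G, l.length = n ∧ (∀ a ∈ l, a ∈ S ∨ a⁻¹ ∈ S) ∧
      l.prod = g}.Nonempty := by
    have hg : g ∈ (Subgroup.closure (S : Set G)).toSubmonoid := hS ▸ Subgroup.mem_top g
    rw [Subgroup.closure_toSubmonoid] at hg
    obtain ⟨l, hl, rfl⟩ := Submonoid.exists_list_of_mem_closure hg
    exact ⟨_, l, rfl, fun a ha => by simpa using hl a ha, rfl⟩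
  exact Nat.sInf_mem hne

theorem dist_one_prod_le (hd : IsPseudometric d) (hl : IsLeftInvariant d) {c : ℝ} (l : List G)
    (hc : ∀ a ∈ l, d 1 a ≤ c) : d 1 l.prod ≤ c * l.length := by
  induction l with
  | nil => simp [hd.self]
  | cons a l ih =>
    have h1 := hd.triangle 1 a (a * l.prod)
    have h2 : d a (a * l.prod) = d 1 l.prod := by simpa using hl a 1 l.prod
    have h3 := hc a (by simp)
    have h4 := ih fun b hb => hc b (by simp [hb])
    rw [List.prod_cons, List.length_cons]
    push_cast
    linarith

theorem exists_dist_one_le (hd : IsPseudometric d) (hl : IsLeftInvariant d) (S : Finset G) :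
    ∃ c, 0 ≤ c ∧ ∀ a, a ∈ S ∨ a⁻¹ ∈ S → d 1 a ≤ c := by
  have h1 : ∀ a ∈ S, d 1 a ≤ ∑ s ∈ S, d 1 s := fun a ha =>
    Finset.single_le_sum (fun s _ => hd.nonneg 1 s) ha
  refine ⟨∑ s ∈ S, d 1 s, Finset.sum_nonneg fun s _ => hd.nonneg 1 s, ?_⟩
  rintro a (ha | ha)
  · exact h1 a ha
  · rw [hd.symm, ← hl.dist_one_inv_mul, mul_one]
    exact h1 _ ha

theorem exists_le_mul_wordMetric (hd : IsPseudometric d) (hl : IsLeftInvariant d)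
    (hS : Subgroup.closure (S : Set G) = ⊤) :
    ∃ c, 0 ≤ c ∧ ∀ x y, d x y ≤ c * wordMetric S x y := by
  obtain ⟨c, hc, h⟩ := exists_dist_one_le hd hl S
  refine ⟨c, hc, fun x y => ?_⟩
  obtain ⟨l, hlen, hmem, hprod⟩ := exists_list_length_eq_wordLength hS (x⁻¹ * y)
  have := dist_one_prod_le hd hl l fun a ha => h a (hmem a ha)
  rwa [hprod, hlen, hl.dist_one_inv_mul] at this

theorem finite_wordLength_le (hS : Subgroup.closure (S : Set G) = ⊤) (n : ℕ) :
    {g : G | wordLength S g ≤ n}.Finite := by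
  set T : Set G := {a | a ∈ S ∨ a⁻¹ ∈ S} with hT
  have hTfin : T.Finite := by
    have : T = ↑S ∪ (↑S)⁻¹ := by ext; simp [hT]
    rw [this]
    exact S.finite_toSet.union S.finite_toSet.inv
  have h1 : ∀ n : ℕ, {g : G | ∃ l : List G, l.length = n ∧ (∀ a ∈ l, a ∈ T) ∧
      l.prod = g}.Finite := by
    intro n
    induction n with
    | zero =>
      refine (Set.finite_singleton 1).subset ?_
      rintro _ ⟨l, hl, -, rfl⟩
      simp [List.length_eq_zero_iff.1 hl]
    | succ n ih =>
      refine (Set.Finite.image2 (· * ·) hTfin ih).subset ?_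
      rintro _ ⟨l, hl, hmem, rfl⟩
      obtain ⟨a, l, rfl⟩ := List.exists_cons_of_length_eq_add_one hl
      exact ⟨a, hmem a (by simp), l.prod, ⟨l, by simpa using hl, fun b hb => hmem b (by simp [hb]),
        rfl⟩, by simp⟩
  refine ((Set.finite_Iic n).biUnion fun m _ => h1 m).subset fun g hg => ?_
  obtain ⟨l, hlen, hmem, hprod⟩ := exists_list_length_eq_wordLength hS g
  exact Set.mem_biUnion (Set.mem_Iic.2 hg) ⟨l, hlen, hmem, hprod⟩

theorem finite_ball_of_areQuasiIsometric (hS : Subgroup.closure (S : Set G) = ⊤)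
    (hq : AreQuasiIsometric d (wordMetric S)) (r : ℝ) : {g | d 1 g ≤ r}.Finite := by
  obtain ⟨l₁, l₂, ε, h₁, h₂, hε, h⟩ := hq
  obtain ⟨n, hn⟩ := exists_nat_ge (l₂ * r + ε)
  refine (finite_wordLength_le hS n).subset fun g hg => ?_
  have hg : d 1 g ≤ r := hg
  have h3 := (h 1 g).2
  have h4 : wordMetric S 1 g = wordLength S g := by simp [wordMetric]
  rw [h4] at h3
  have h5 : (wordLength S g : ℝ) ≤ n := by nlinarith
  exact_mod_cast h5

theorem hasLinearChains_of_areQuasiIsometric (hd : IsPseudometric d) (hl : IsLeftInvariant d)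
    (hS : Subgroup.closure (S : Set G) = ⊤) (hq : AreQuasiIsometric d (wordMetric S)) :
    HasLinearChains d := by
  obtain ⟨l₁, l₂, ε, h₁, h₂, hε, h⟩ := hq
  obtain ⟨c, hc, hcS⟩ := exists_dist_one_le hd hl S
  refine ⟨c, l₂ + ε, hc, by linarith, fun x y => ?_⟩
  obtain ⟨l, hlen, hmem, hprod⟩ := exists_list_length_eq_wordLength hS (x⁻¹ * y)
  refine ⟨l.length, fun i => x * (l.take i).prod, by simp, by simp [hprod], fun i hi => ?_, ?_⟩
  · beta_reduce
    rw [List.prod_take_succ l i hi, ← mul_assoc]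
    have := hl (x * (l.take i).prod) 1 l[i]
    rw [mul_one] at this
    rw [this]
    exact hcS _ (hmem _ (List.getElem_mem hi))
  · have h3 := (h x y).2
    have h4 : wordMetric S x y = l.length := by rw [wordMetric, hlen]
    rw [h4] at h3
    have := hd.nonneg x y
    nlinarith

end Word

/-! ### Stretch factors and dilations -/

section Dilation

variable {G : Type*} [Group G] {d d' : G → G → ℝ}

theorem exists_le_mul_add (hd : d ∈ hypPseudometrics G) (hd' : d' ∈ hypPseudometrics G) :
    ∃ L A, 0 < L ∧ 0 ≤ A ∧ ∀ x y, d x y ≤ L * d' x y + A := by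
  obtain ⟨hp, -, hl, -⟩ := hd
  obtain ⟨-, -, -, S, hS, l₁, l₂, ε, h₁, h₂, hε, h⟩ := hd'
  obtain ⟨c, hc, hc'⟩ := exists_le_mul_wordMetric hp hl hS
  refine ⟨(c + 1) * l₂, (c + 1) * ε, by positivity, by positivity, fun x y => ?_⟩
  have h3 := (h x y).2
  have h4 : (0 : ℝ) ≤ wordMetric S x y := Nat.cast_nonneg _
  calc d x y ≤ c * wordMetric S x y := hc' x y
    _ ≤ (c + 1) * wordMetric S x y := by linarith
    _ ≤ (c + 1) * (l₂ * d' x y + ε) := by gcongr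
    _ = (c + 1) * l₂ * d' x y + (c + 1) * ε := by ring

theorem exists_dist_one_le_translationLength_add (hd : d ∈ hypPseudometrics G)
    (hne : ¬ IsVirtuallyAbelian G) :
    ∃ (F : Finset G) (C : ℝ), ∀ g, ∃ f ∈ F, d 1 g - C ≤ translationLength d (g * f) := by
  obtain ⟨hp, hh, hl, S, hS, hq⟩ := hd
  obtain ⟨δ, hδ, h⟩ := hh.exists_fourPoint
  exact exists_finset_le_translationLength hp hl hδ h
    (h.isRoughlyGeodesic hp hδ (hasLinearChains_of_areQuasiIsometric hp hl hS hq))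
    (finite_ball_of_areQuasiIsometric hS hq) hne

theorem exists_translationLength_pos (hd : d ∈ hypPseudometrics G)
    (hne : ¬ IsVirtuallyAbelian G) : ∃ x : G, 0 < translationLength d x := by
  obtain ⟨F, C, hF⟩ := exists_dist_one_le_translationLength_add hd hne
  obtain ⟨hp, hh, hl, S, hS, hq⟩ := hd
  have hinf : Infinite G := by
    by_contra hG
    have : Finite G := not_infinite_iff_finite.1 hG
    exact hne isVirtuallyAbelian_of_finite
  obtain ⟨g, hg⟩ := (finite_ball_of_areQuasiIsometric hS hq C).exists_notMem
  obtain ⟨f, -, hf⟩ := hF g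
  have hg : C < d 1 g := not_le.1 hg
  exact ⟨g * f, by linarith⟩

theorem lengthRatio_le (hd : d ∈ hypPseudometrics G) (hd' : d' ∈ hypPseudometrics G) {L A : ℝ}
    (hL : 0 ≤ L) (h : ∀ x y, d x y ≤ L * d' x y + A) (x : G) :
    translationLength d x / translationLength d' x ≤ L :=
  div_le_of_le_mul₀ (translationLength_nonneg hd'.1 hd'.2.2.1 x) hL
    (translationLength_le_mul hd.1 hd.2.2.1 hd'.1 hd'.2.2.1 h x)

theorem bddAbove_lengthRatios (hd : d ∈ hypPseudometrics G) (hd' : d' ∈ hypPseudometrics G) :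
    BddAbove (lengthRatios d d') := by
  obtain ⟨L, A, hL, -, h⟩ := exists_le_mul_add hd hd'
  refine ⟨L, ?_⟩
  rintro _ ⟨x, -, rfl⟩
  exact lengthRatio_le hd hd' hL.le h x

theorem exists_pos_mem_lengthRatios (hd : d ∈ hypPseudometrics G) (hd' : d' ∈ hypPseudometrics G)
    (hne : ¬ IsVirtuallyAbelian G) : ∃ r ∈ lengthRatios d d', 0 < r := by
  obtain ⟨x, hx⟩ := exists_translationLength_pos hd hne
  obtain ⟨L, A, hL, -, h⟩ := exists_le_mul_add hd hd'
  have h1 := translationLength_le_mul hd.1 hd.2.2.1 hd'.1 hd'.2.2.1 h x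
  have h2 : 0 < translationLength d' x := by
    by_contra! h2
    nlinarith
  refine ⟨_, ⟨x, fun hfin => ?_, rfl⟩, div_pos hx h2⟩
  rw [translationLength_of_isOfFinOrder hd.1 hd.2.2.1 hfin] at hx
  exact hx.false

theorem Dil_pos (hd : d ∈ hypPseudometrics G) (hd' : d' ∈ hypPseudometrics G)
    (hne : ¬ IsVirtuallyAbelian G) : 0 < Dil d d' := by
  obtain ⟨r, hr, hr0⟩ := exists_pos_mem_lengthRatios hd hd' hne
  exact hr0.trans_le (le_csSup (bddAbove_lengthRatios hd hd') hr)

theorem Dil_le (hd : d ∈ hypPseudometrics G) (hd' : d' ∈ hypPseudometrics G)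
    (hne : ¬ IsVirtuallyAbelian G) {L A : ℝ}
    (hL : 0 ≤ L) (h : ∀ x y, d x y ≤ L * d' x y + A) : Dil d d' ≤ L := by
  obtain ⟨r, hr, -⟩ := exists_pos_mem_lengthRatios hd hd' hne
  refine csSup_le ⟨r, hr⟩ ?_
  rintro _ ⟨x, -, rfl⟩
  exact lengthRatio_le hd hd' hL h x

theorem translationLength_le_Dil_mul (hd : d ∈ hypPseudometrics G)
    (hd' : d' ∈ hypPseudometrics G) (x : G) :
    translationLength d x ≤ Dil d d' * translationLength d' x := by
  obtain ⟨L, A, hL, -, h⟩ := exists_le_mul_add hd hd'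
  have h1 := translationLength_le_mul hd.1 hd.2.2.1 hd'.1 hd'.2.2.1 h x
  by_cases hx : IsOfFinOrder x
  · simp [translationLength_of_isOfFinOrder hd.1 hd.2.2.1 hx,
      translationLength_of_isOfFinOrder hd'.1 hd'.2.2.1 hx]
  rcases (translationLength_nonneg hd'.1 hd'.2.2.1 x).eq_or_lt with h2 | h2
  · rw [← h2] at h1 ⊢
    linarith
  · rw [← div_le_iff₀ h2]
    exact le_csSup (bddAbove_lengthRatios hd hd') ⟨x, hx, rfl⟩

/-- The supremum defining the dilation is an admissible multiplicative constant: distances are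
translation lengths up to bounded factors on the right. -/
theorem exists_le_Dil_mul_add (hd : d ∈ hypPseudometrics G) (hd' : d' ∈ hypPseudometrics G)
    (hne : ¬ IsVirtuallyAbelian G) : ∃ A, 0 ≤ A ∧ ∀ x y, d x y ≤ Dil d d' * d' x y + A := by
  obtain ⟨F, C, hF⟩ := exists_dist_one_le_translationLength_add hd hne
  have hD := Dil_pos hd hd' hne
  have key := translationLength_le_Dil_mul hd hd'
  obtain ⟨hp, -, hl, -⟩ := hd
  obtain ⟨hp', -, hl', -⟩ := hd'
  obtain ⟨B, hB, hB'⟩ := exists_dist_one_le hp' hl' F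
  refine ⟨|C| + Dil d d' * B, by positivity, fun x y => ?_⟩
  obtain ⟨f, hf, h⟩ := hF (x⁻¹ * y)
  rw [hl.dist_one_inv_mul] at h
  have h1 := translationLength_le hp' hl' (x⁻¹ * y * f)
  have h2 := hp'.triangle 1 (x⁻¹ * y) (x⁻¹ * y * f)
  have h3 : d' (x⁻¹ * y) (x⁻¹ * y * f) = d' 1 f := by simpa using hl' (x⁻¹ * y) 1 f
  have h4 := hB' f (Or.inl hf)
  rw [hl'.dist_one_inv_mul, h3] at h2
  rw [hp'.symm] at h1
  have h5 : translationLength d' (x⁻¹ * y * f) ≤ d' x y + B := by linarith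
  have h6 := mul_le_mul_of_nonneg_left h5 hD.le
  have h7 := key (x⁻¹ * y * f)
  have h8 := le_abs_self C
  linarith

theorem Dil_mul_Dil_mem_qiConstants (hd : d ∈ hypPseudometrics G) (hd' : d' ∈ hypPseudometrics G)
    (hne : ¬ IsVirtuallyAbelian G) : Dil d d' * Dil d' d ∈ qiConstants d d' := by
  obtain ⟨A, hA, h⟩ := exists_le_Dil_mul_add hd hd' hne
  obtain ⟨A', hA', h'⟩ := exists_le_Dil_mul_add hd' hd hne
  have hD' := Dil_pos hd' hd hne
  refine ⟨Dil d' d, Dil d d', hD', Dil_pos hd hd' hne, mul_comm _ _, A + A' / Dil d' d,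
    by positivity, fun x y => ⟨?_, ?_⟩⟩
  · have h1 := div_le_div_of_nonneg_right (h' x y) hD'.le
    rw [add_div, mul_div_cancel_left₀ _ hD'.ne'] at h1
    rw [one_div_mul_eq_div]
    linarith
  · have := h x y
    have : 0 ≤ A' / Dil d' d := by positivity
    linarith

theorem sInf_qiConstants (hd : d ∈ hypPseudometrics G) (hd' : d' ∈ hypPseudometrics G)
    (hne : ¬ IsVirtuallyAbelian G) : sInf (qiConstants d d') = Dil d d' * Dil d' d := by
  refine IsLeast.csInf_eq ⟨Dil_mul_Dil_mem_qiConstants hd hd' hne, ?_⟩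
  rintro _ ⟨l₁, l₂, h₁, h₂, rfl, A, hA, h⟩
  rw [mul_comm l₁]
  refine mul_le_mul (Dil_le hd hd' hne h₂.le fun x y => (h x y).2)
    (Dil_le hd' hd hne h₁.le (A := l₁ * A) fun x y => ?_) (Dil_pos hd' hd hne).le h₂.le
  have h3 := mul_le_mul_of_nonneg_left (h x y).1 h₁.le
  rw [mul_sub, ← mul_assoc, mul_one_div_cancel h₁.ne', one_mul] at h3
  linarith

end Dilation

/-! ### Geometry of the hyperbolic plane -/

section Plane

theorem exp_le_four_mul_sinh {a : ℝ} (ha : 1 / 2 ≤ a) : Real.exp a ≤ 4 * Real.sinh a := by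
  rw [Real.sinh_eq]
  have h1 : (3 : ℝ) / 2 ≤ Real.exp a := by
    have := Real.add_one_le_exp a
    linarith
  have h2 : Real.exp a * Real.exp (-a) = 1 := by rw [← Real.exp_add]; simp
  nlinarith [Real.exp_pos (-a)]

/-- Ptolemy's inequality for half distances, from the Euclidean one. -/
theorem sinh_half_dist_mul_le (x y z w : UpperHalfPlane) :
    Real.sinh (dist x z / 2) * Real.sinh (dist y w / 2) ≤
      Real.sinh (dist x y / 2) * Real.sinh (dist z w / 2) +
        Real.sinh (dist y z / 2) * Real.sinh (dist x w / 2) := by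
  simp only [UpperHalfPlane.sinh_half_dist]
  have h := EuclideanGeometry.mul_dist_le_mul_dist_add_mul_dist (x : ℂ) (y : ℂ) (z : ℂ) (w : ℂ)
  have hx := x.im_pos
  have hy := y.im_pos
  have hz := z.im_pos
  have hw := w.im_pos
  simp only [Real.sqrt_mul hx.le, Real.sqrt_mul hy.le, Real.sqrt_mul hz.le]
  have e1 : dist (x : ℂ) y / (2 * (√x.im * √y.im)) * (dist (z : ℂ) w / (2 * (√z.im * √w.im))) +
      dist (y : ℂ) z / (2 * (√y.im * √z.im)) * (dist (x : ℂ) w / (2 * (√x.im * √w.im))) =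
      (dist (x : ℂ) y * dist (z : ℂ) w + dist (y : ℂ) z * dist (x : ℂ) w) /
        (4 * (√x.im * √y.im * √z.im * √w.im)) := by
    field_simp
    ring
  have e2 : dist (x : ℂ) z / (2 * (√x.im * √z.im)) * (dist (y : ℂ) w / (2 * (√y.im * √w.im))) =
      dist (x : ℂ) z * dist (y : ℂ) w / (4 * (√x.im * √y.im * √z.im * √w.im)) := by
    field_simp
    ring
  rw [e1, e2]
  exact div_le_div_of_nonneg_right h (by positivity)

/-- The hyperbolic plane is Gromov hyperbolic: for large distances, Ptolemy's inequality for
`sinh (dist / 2)` is the exponential form of the four-point inequality. -/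
theorem fourPoint_dist_upperHalfPlane :
    FourPoint (fun z w : UpperHalfPlane => dist z w) (1 + Real.log 8) := by
  intro x y z w
  have hlog : 0 ≤ Real.log 8 := Real.log_nonneg (by norm_num)
  simp only
  by_cases h1 : dist x z ≤ 1
  · have := dist_triangle4 y x z w
    have := dist_triangle4 y z x w
    have := le_max_right (dist x y + dist z w) (dist x w + dist y z)
    rw [dist_comm z x] at *
    linarith
  by_cases h2 : dist y w ≤ 1
  · have := dist_triangle4 x w y z
    have := le_max_right (dist x y + dist z w) (dist x w + dist y z)
    rw [dist_comm w y] at *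
    linarith
  push Not at h1 h2
  have h3 := exp_le_four_mul_sinh (a := dist x z / 2) (by linarith)
  have h4 := exp_le_four_mul_sinh (a := dist y w / 2) (by linarith)
  have hs : ∀ a b : ℝ, 0 ≤ b → Real.sinh a * Real.sinh b ≤ Real.exp (a + b) / 4 := by
    intro a b hb
    have hb' := Real.sinh_nonneg_iff.2 hb
    have ha : Real.sinh a ≤ Real.exp a / 2 := by
      rw [Real.sinh_eq]; linarith [Real.exp_pos (-a)]
    have hb2 : Real.sinh b ≤ Real.exp b / 2 := by
      rw [Real.sinh_eq]; linarith [Real.exp_pos (-b)]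
    rw [Real.exp_add]
    nlinarith [Real.exp_pos a]
  set m := max (dist x y + dist z w) (dist x w + dist y z) with hm
  have hm1 : dist x y / 2 + dist z w / 2 ≤ m / 2 := by
    have := le_max_left (dist x y + dist z w) (dist x w + dist y z)
    linarith
  have hm2 : dist y z / 2 + dist x w / 2 ≤ m / 2 := by
    have := le_max_right (dist x y + dist z w) (dist x w + dist y z)
    linarith
  have h5 := hs (dist x y / 2) (dist z w / 2) (by positivity)
  have h6 := hs (dist y z / 2) (dist x w / 2) (by positivity)
  have h7 := Real.exp_le_exp.2 hm1
  have h8 := Real.exp_le_exp.2 hm2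
  have h9 := sinh_half_dist_mul_le x y z w
  have h10 : Real.exp (dist x z / 2 + dist y w / 2) ≤ 8 * Real.exp (m / 2) := by
    rw [Real.exp_add]
    have := mul_le_mul h3 h4 (Real.exp_pos _).le ((Real.exp_pos _).le.trans h3)
    linarith
  rw [← Real.exp_log (show (0 : ℝ) < 8 by norm_num), ← Real.exp_add, Real.exp_le_exp] at h10
  linarith

/-- `m` is the midpoint of `x` and `y`, expressed by the length of the medians `p m` of all
triangles `x y p`. In the hyperboloid model this says that `m` is the normalized sum of
`x` and `y`. -/
def IsMidpoint (m x y : UpperHalfPlane) : Prop :=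
  ∀ p, 2 * Real.cosh (dist x y / 2) * Real.cosh (dist m p) =
    Real.cosh (dist x p) + Real.cosh (dist y p)

/-- The formula for the median of a hyperbolic triangle in half-plane coordinates, with
`k = 2 cosh (dist / 2)` for the side that is bisected. -/
theorem median_identity {k x₁ x₂ y₁ y₂ p q : ℝ} (hk : 0 < k) (h₁ : 0 < y₁) (h₂ : 0 < y₂)
    (hq : 0 < q) (hk2 : k ^ 2 * (y₁ * y₂) = (x₁ - x₂) ^ 2 + (y₁ + y₂) ^ 2) :
    k * ((((x₁ * y₂ + x₂ * y₁) / (y₁ + y₂) - p) ^ 2 + (k * (y₁ * y₂) / (y₁ + y₂)) ^ 2 + q ^ 2) /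
        (2 * (k * (y₁ * y₂) / (y₁ + y₂)) * q)) =
      ((x₁ - p) ^ 2 + y₁ ^ 2 + q ^ 2) / (2 * y₁ * q) +
        ((x₂ - p) ^ 2 + y₂ ^ 2 + q ^ 2) / (2 * y₂ * q) := by
  have e : (k * (y₁ * y₂) / (y₁ + y₂)) ^ 2 =
      ((x₁ - x₂) ^ 2 + (y₁ + y₂) ^ 2) * (y₁ * y₂) / (y₁ + y₂) ^ 2 := by
    rw [← hk2]
    field_simp
  rw [e]
  field_simp
  ring

theorem exists_isMidpoint (x y : UpperHalfPlane) : ∃ m, IsMidpoint m x y := by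
  set k := 2 * Real.cosh (dist x y / 2) with hk
  have hk0 : 0 < k := by positivity
  have hx := x.im_pos
  have hy := y.im_pos
  have hk2 : k ^ 2 * (x.im * y.im) = (x.re - y.re) ^ 2 + (x.im + y.im) ^ 2 := by
    have h1 := Real.cosh_two_mul (dist x y / 2)
    have h2 := Real.sinh_sq (dist x y / 2)
    rw [mul_div_cancel₀ _ two_ne_zero, h2, UpperHalfPlane.cosh_dist'] at h1
    have h3 : k ^ 2 = 2 + 2 * (((x.re - y.re) ^ 2 + x.im ^ 2 + y.im ^ 2) / (2 * x.im * y.im)) := by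
      rw [h1, hk]; ring
    rw [h3]
    field_simp
    ring
  -- the normalized sum of the vectors `(1, re, re² + im²) / im` of the hyperboloid model
  refine ⟨⟨⟨(x.re * y.im + y.re * x.im) / (x.im + y.im), k * (x.im * y.im) / (x.im + y.im)⟩,
    by simp only; positivity⟩, fun p => ?_⟩
  have hp := p.im_pos
  simp only [UpperHalfPlane.cosh_dist']
  exact median_identity hk0 hx hy hp hk2

theorem IsMidpoint.map {m x y : UpperHalfPlane} (h : IsMidpoint m x y)
    (f : UpperHalfPlane ≃ᵢ UpperHalfPlane) : IsMidpoint (f m) (f x) (f y) := by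
  intro p
  obtain ⟨p, rfl⟩ := f.surjective p
  simp only [f.dist_eq]
  exact h p

theorem IsMidpoint.symm {m x y : UpperHalfPlane} (h : IsMidpoint m x y) : IsMidpoint m y x := by
  intro p
  rw [dist_comm y x, add_comm]
  exact h p

theorem IsMidpoint.dist_left {m x y : UpperHalfPlane} (h : IsMidpoint m x y) :
    dist x m = dist x y / 2 := by
  have h1 := h x
  rw [dist_self, Real.cosh_zero, dist_comm y x, dist_comm m x] at h1
  have h2 := Real.cosh_two_mul (dist x y / 2)
  have h3 := Real.sinh_sq (dist x y / 2)
  rw [mul_div_cancel₀ _ two_ne_zero, h3] at h2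
  have h4 : Real.cosh (dist x m) = Real.cosh (dist x y / 2) := by
    have := Real.cosh_pos (dist x y / 2)
    refine mul_left_cancel₀ (mul_pos two_pos this).ne' ?_
    rw [h1, h2]; ring
  have h5 := le_antisymm (Real.cosh_le_cosh.1 h4.le) (Real.cosh_le_cosh.1 h4.ge)
  rwa [abs_of_nonneg dist_nonneg, abs_of_nonneg (by positivity)] at h5

theorem IsMidpoint.dist_right {m x y : UpperHalfPlane} (h : IsMidpoint m x y) :
    dist m y = dist x y / 2 := by
  rw [dist_comm, h.symm.dist_left, dist_comm]

/-- The midsegment of a hyperbolic triangle is at most half as long as the opposite side. -/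
theorem dist_midpoints_le {m n x y z : UpperHalfPlane} (hm : IsMidpoint m x y)
    (hn : IsMidpoint n y z) : dist m n ≤ dist x z / 2 := by
  have h1 := hm n
  have h2 := hn x
  have h3 := hn.dist_left
  set a := dist x y / 2 with ha
  set b := dist y z / 2 with hb
  set c := dist x z / 2 with hc
  have ea : dist y x = 2 * a := by rw [dist_comm]; linarith
  have ec : dist z x = 2 * c := by rw [dist_comm]; linarith
  have dbl : ∀ t : ℝ, Real.cosh (2 * t) = 2 * Real.cosh t ^ 2 - 1 := fun t => by
    rw [Real.cosh_two_mul, Real.sinh_sq]; ring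
  rw [dist_comm n x, ea, ec, dbl, dbl] at h2
  rw [h3] at h1
  have hA := Real.cosh_pos a
  have hB := Real.cosh_pos b
  -- the triangle inequality for `2 * a, 2 * b, 2 * c` in terms of hyperbolic cosines
  have hub : Real.cosh c ≤ Real.cosh (a + b) := by
    rw [Real.cosh_le_cosh]
    have := dist_triangle x y z
    rw [abs_of_nonneg (by positivity), abs_of_nonneg (by positivity)]
    linarith
  have hlb : Real.cosh (a - b) ≤ Real.cosh c := by
    rw [Real.cosh_le_cosh, abs_of_nonneg (show 0 ≤ c by positivity), abs_le]
    have := dist_triangle y x z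
    have := dist_triangle x z y
    have := dist_comm z y
    constructor <;> linarith
  rw [Real.cosh_add] at hub
  rw [Real.cosh_sub] at hlb
  have hS := Real.sinh_sq a
  have hT := Real.sinh_sq b
  have key : Real.cosh a ^ 2 + Real.cosh b ^ 2 + Real.cosh c ^ 2 - 1 ≤
      2 * Real.cosh a * Real.cosh b * Real.cosh c := by
    have h4 := mul_nonneg (sub_nonneg.2 hub) (sub_nonneg.2 hlb)
    have h5 : (Real.sinh a * Real.sinh b) ^ 2 = (Real.cosh a ^ 2 - 1) * (Real.cosh b ^ 2 - 1) := by
      rw [mul_pow, hS, hT]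
    nlinarith
  have h4 : 4 * Real.cosh a * Real.cosh b * Real.cosh (dist m n) =
      2 * (Real.cosh a ^ 2 + Real.cosh b ^ 2 + Real.cosh c ^ 2 - 1) := by
    calc _ = 2 * Real.cosh b * (2 * Real.cosh a * Real.cosh (dist m n)) := by ring
      _ = 2 * Real.cosh b * Real.cosh (dist x n) + 2 * Real.cosh b ^ 2 := by rw [h1]; ring
      _ = _ := by rw [h2]; ring
  have h5 : Real.cosh (dist m n) ≤ Real.cosh c := by
    have : 0 < Real.cosh a * Real.cosh b := mul_pos hA hB
    nlinarith
  rwa [Real.cosh_le_cosh, abs_of_nonneg dist_nonneg,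
    abs_of_nonneg (show 0 ≤ c by positivity)] at h5

/-- Chains with steps of length at most `1`, by iterated bisection. -/
theorem exists_chain_upperHalfPlane (k : ℕ) : ∀ x y : UpperHalfPlane, dist x y ≤ 2 ^ k →
    ∃ u : ℕ → UpperHalfPlane, u 0 = x ∧ u (2 ^ k) = y ∧
      ∀ i < 2 ^ k, dist (u i) (u (i + 1)) ≤ 1 := by
  induction k with
  | zero =>
    intro x y h
    refine ⟨fun i => if i = 0 then x else y, by simp, by simp, fun i hi => ?_⟩
    obtain rfl : i = 0 := by simpa using hi
    simpa using h
  | succ k ih =>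
    intro x y h
    obtain ⟨m, hm⟩ := exists_isMidpoint x y
    have h1 : dist x y / 2 ≤ 2 ^ k := by rw [pow_succ] at h; linarith
    obtain ⟨u, hu0, hu1, hu⟩ := ih x m (hm.dist_left.trans_le h1)
    obtain ⟨v, hv0, hv1, hv⟩ := ih m y (hm.dist_right.trans_le h1)
    refine ⟨fun i => if i ≤ 2 ^ k then u i else v (i - 2 ^ k), by simp [hu0], ?_, fun i hi => ?_⟩
    · have : 2 ^ (k + 1) - 2 ^ k = 2 ^ k := by rw [pow_succ]; omega
      have h2 : ¬ 2 ^ (k + 1) ≤ 2 ^ k := by simp [pow_succ]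
      simp only [if_neg h2, this, hv1]
    · rw [pow_succ] at hi
      rcases lt_trichotomy i (2 ^ k) with h2 | rfl | h2
      · simpa [h2.le, Nat.succ_le_of_lt h2] using hu i h2
      · simpa [hu1, ← hv0] using hv 0 (by positivity)
      · have h3 := hv (i - 2 ^ k) (by omega)
        have h4 : i + 1 - 2 ^ k = i - 2 ^ k + 1 := by omega
        simpa [not_le.2 h2, not_le.2 (h2.trans (Nat.lt_succ_self i)), h4] using h3

theorem hasLinearChains_upperHalfPlane :
    HasLinearChains (fun z w : UpperHalfPlane => dist z w) := by
  refine ⟨1, 2, zero_le_one, zero_le_two, fun x y => ?_⟩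
  obtain ⟨k, hk, hk'⟩ : ∃ k : ℕ, dist x y ≤ 2 ^ k ∧ (2 : ℝ) ^ k ≤ 2 * dist x y + 2 := by
    obtain ⟨k, h1, h2⟩ := exists_nat_pow_near
      (le_add_of_nonneg_left (dist_nonneg (x := x) (y := y)))
      (one_lt_two (α := ℝ))
    refine ⟨k + 1, by linarith, ?_⟩
    rw [pow_succ]; linarith
  obtain ⟨u, hu0, hu1, hu⟩ := exists_chain_upperHalfPlane k x y hk
  exact ⟨2 ^ k, u, hu0, hu1, hu, by push_cast; exact hk'⟩

end Plane

/-! ### Orbit pseudometrics of surface actions -/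

section Surface

variable {G : Type*} [Group G]

theorem isPseudometric_orbitPseudometric (φ : SurfaceAction G) (o : UpperHalfPlane) :
    IsPseudometric (orbitPseudometric φ o) :=
  ⟨fun _ => dist_self _, fun _ _ => dist_comm _ _, fun _ _ _ => dist_triangle _ _ _⟩

theorem isLeftInvariant_orbitPseudometric (φ : SurfaceAction G) (o : UpperHalfPlane) :
    IsLeftInvariant (orbitPseudometric φ o) := fun g x y => by
  simp only [orbitPseudometric, map_mul, IsometryEquiv.mul_apply, IsometryEquiv.dist_eq]

theorem orbitPseudometric_one_left (φ : SurfaceAction G) (o : UpperHalfPlane) (g : G) :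
    orbitPseudometric φ o 1 g = dist o (φ.1 g o) := by
  simp [orbitPseudometric]

theorem isGromovHyperbolic_orbitPseudometric (φ : SurfaceAction G) (o : UpperHalfPlane) :
    IsGromovHyperbolic (orbitPseudometric φ o) := by
  have hlog : 0 ≤ Real.log 8 := Real.log_nonneg (by norm_num)
  exact FourPoint.isGromovHyperbolic (δ := 1 + Real.log 8) (by linarith)
    fun x y z w => fourPoint_dist_upperHalfPlane _ _ _ _

theorem finite_dist_orbit_le (φ : SurfaceAction G) (o : UpperHalfPlane) (r : ℝ) :
    {g : G | dist o (φ.1 g o) ≤ r}.Finite := by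
  rcases lt_or_ge r 0 with hr | hr
  · convert Set.finite_empty
    ext g
    simpa using hr.trans_le dist_nonneg
  · refine (φ.2.properlyDiscontinuous _ (isCompact_closedBall o r)).subset fun g hg => ?_
    exact ⟨φ.1 g o, ⟨o, Metric.mem_closedBall_self hr, rfl⟩, by
      rw [Metric.mem_closedBall, dist_comm]; exact hg⟩

theorem exists_dist_orbit_le (φ : SurfaceAction G) (o : UpperHalfPlane) :
    ∃ R, 0 ≤ R ∧ ∀ z, ∃ g : G, dist z (φ.1 g o) ≤ R := by
  obtain ⟨K, hK, hcov⟩ := φ.2.cocompact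
  obtain ⟨R, hR⟩ := hK.isBounded.subset_closedBall o
  refine ⟨max R 0, le_max_right _ _, fun z => ?_⟩
  obtain ⟨g, y, hy, rfl⟩ := Set.mem_iUnion.1 (hcov.symm ▸ Set.mem_univ z)
  refine ⟨g, ?_⟩
  rw [IsometryEquiv.dist_eq]
  exact (hR hy).trans (le_max_left _ _)

theorem exists_list_of_chain {T : Set G} (v : ℕ → G) (n : ℕ)
    (h : ∀ i < n, (v i)⁻¹ * v (i + 1) ∈ T) :
    ∃ l : List G, l.length = n ∧ (∀ a ∈ l, a ∈ T) ∧ l.prod = (v 0)⁻¹ * v n := by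
  induction n with
  | zero => exact ⟨[], rfl, by simp, by simp⟩
  | succ n ih =>
    obtain ⟨l, hlen, hmem, hprod⟩ := ih fun i hi => h i (hi.trans (Nat.lt_succ_self n))
    refine ⟨l ++ [(v n)⁻¹ * v (n + 1)], by simp [hlen], fun a ha => ?_, by simp [hprod, mul_assoc]⟩
    rcases List.mem_append.1 ha with ha | ha
    · exact hmem a ha
    · rw [List.mem_singleton.1 ha]
      exact h n (Nat.lt_succ_self n)

/-- The Milnor–Švarc lemma for surface actions. -/
theorem exists_areQuasiIsometric_orbitPseudometric (φ : SurfaceAction G) (o : UpperHalfPlane) :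
    ∃ S : Finset G, Subgroup.closure (S : Set G) = ⊤ ∧
      AreQuasiIsometric (orbitPseudometric φ o) (wordMetric S) := by
  set d := orbitPseudometric φ o with hd
  have hp : IsPseudometric d := isPseudometric_orbitPseudometric φ o
  have hl : IsLeftInvariant d := isLeftInvariant_orbitPseudometric φ o
  obtain ⟨R, hR0, hR⟩ := exists_dist_orbit_le φ o
  obtain ⟨c, L, hc, hL, hchain⟩ := hasLinearChains_upperHalfPlane
  set S := (finite_dist_orbit_le φ o (2 * R + c)).toFinset with hS
  have hmemS : ∀ x y : G, dist (φ.1 x o) (φ.1 y o) ≤ 2 * R + c → x⁻¹ * y ∈ S := by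
    intro x y h
    rw [hS, Set.Finite.mem_toFinset, Set.mem_ofPred_eq, ← orbitPseudometric_one_left,
      ← hd, hl.dist_one_inv_mul]
    exact h
  have key : ∀ x y : G, ∃ l : List G, (l.length : ℝ) ≤ L * d x y + L + 2 ∧ (∀ a ∈ l, a ∈ S) ∧
      l.prod = x⁻¹ * y := by
    intro x y
    obtain ⟨n, u, hu0, hun, hu, hn⟩ := hchain (φ.1 x o) (φ.1 y o)
    choose v hv using fun i => hR (u i)
    obtain ⟨l, hlen, hmem, hprod⟩ := exists_list_of_chain (T := (S : Set G)) v n fun i hi => by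
      refine hmemS _ _ ?_
      have h1 := dist_triangle4 (φ.1 (v i) o) (u i) (u (i + 1)) (φ.1 (v (i + 1)) o)
      have h2 := hv i
      have h3 := hv (i + 1)
      have h4 := hu i hi
      rw [dist_comm] at h2
      linarith
    have hx : x⁻¹ * v 0 ∈ S := hmemS _ _ (by
      have := hv 0
      rw [hu0] at this
      linarith)
    have hy : (v n)⁻¹ * y ∈ S := hmemS _ _ (by
      have := hv n
      rw [hun, dist_comm] at this
      linarith)
    refine ⟨(x⁻¹ * v 0) :: (l ++ [(v n)⁻¹ * y]), ?_, ?_, ?_⟩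
    · have : (n : ℝ) ≤ L * d x y + L := hn
      simp only [List.length_cons, List.length_append, hlen, List.length_nil]
      push_cast
      linarith
    · intro a ha
      simp only [List.mem_cons, List.mem_append, List.not_mem_nil, or_false] at ha
      rcases ha with rfl | ha | rfl
      · exact hx
      · exact hmem a ha
      · exact hy
    · simp [hprod, mul_assoc]
  have hgen : Subgroup.closure (S : Set G) = ⊤ := by
    refine eq_top_iff.2 fun g _ => ?_
    obtain ⟨l, -, hmem, hprod⟩ := key 1 g
    rw [inv_one, one_mul] at hprod
    rw [← hprod]
    exact Subgroup.list_prod_mem _ fun a ha => Subgroup.subset_closure (hmem a ha)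
  obtain ⟨e, he, he'⟩ := exists_le_mul_wordMetric hp hl hgen
  refine ⟨S, hgen, e + 1, L + 1, L + 2, by positivity, by positivity, by positivity,
    fun x y => ⟨?_, ?_⟩⟩
  · have h1 : (0 : ℝ) ≤ wordMetric S x y := Nat.cast_nonneg _
    have h2 := he' x y
    have h3 : 1 / (e + 1) * d x y ≤ wordMetric S x y := by
      rw [one_div_mul_eq_div, div_le_iff₀ (by positivity)]
      linarith
    linarith
  · obtain ⟨l, hlen, hmem, hprod⟩ := key x y
    have h1 : wordLength S (x⁻¹ * y) ≤ l.length :=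
      Nat.sInf_le ⟨l, rfl, fun a ha => Or.inl (hmem a ha), hprod⟩
    have h2 : wordMetric S x y ≤ l.length := Nat.cast_le.2 h1
    have h3 := hp.nonneg x y
    linarith

theorem orbitPseudometric_mem_hypPseudometrics (φ : SurfaceAction G) (o : UpperHalfPlane) :
    orbitPseudometric φ o ∈ hypPseudometrics G :=
  ⟨isPseudometric_orbitPseudometric φ o, isGromovHyperbolic_orbitPseudometric φ o,
    isLeftInvariant_orbitPseudometric φ o, exists_areQuasiIsometric_orbitPseudometric φ o⟩

theorem orbitPseudometric_le_add (φ : SurfaceAction G) (o o' : UpperHalfPlane) (x y : G) :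
    orbitPseudometric φ o x y ≤ orbitPseudometric φ o' x y + 2 * dist o o' := by
  have h1 := dist_triangle4 (φ.1 x o) (φ.1 x o') (φ.1 y o') (φ.1 y o)
  rw [IsometryEquiv.dist_eq, IsometryEquiv.dist_eq, dist_comm o' o] at h1
  simp only [orbitPseudometric]
  linarith

theorem roughlySimilar_orbitPseudometric (φ : SurfaceAction G) (o o' : UpperHalfPlane) :
    RoughlySimilar (orbitPseudometric φ o) (orbitPseudometric φ o') := by
  refine ⟨1, 2 * dist o o' + 1, one_pos, by positivity, fun x y => ?_⟩
  have h1 := orbitPseudometric_le_add φ o o' x y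
  have h2 := orbitPseudometric_le_add φ o' o x y
  rw [dist_comm o' o] at h2
  rw [abs_le]
  constructor <;> linarith

/-- The metric structure of a point of Teichmüller space, computed with the base point `i`. -/
noncomputable def teichmullerMetricStructure : TeichmullerSpace G → MetricStructure G :=
  Quotient.lift
    (fun φ : SurfaceAction G => metricStructureOf
      ⟨orbitPseudometric φ UpperHalfPlane.I, orbitPseudometric_mem_hypPseudometrics φ _⟩)
    (by
      rintro φ ψ ⟨f, hf⟩
      refine Quotient.sound (?_ : RoughlySimilar _ _)
      have e : orbitPseudometric ψ UpperHalfPlane.I =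
          orbitPseudometric φ (f⁻¹ UpperHalfPlane.I) := by
        funext x y
        simp only [orbitPseudometric, hf, IsometryEquiv.mul_apply, IsometryEquiv.dist_eq]
      simp only [e]
      exact roughlySimilar_orbitPseudometric φ _ _)

theorem teichmullerMetricStructure_teichmullerPoint (φ : SurfaceAction G) (o : UpperHalfPlane) :
    teichmullerMetricStructure (teichmullerPoint φ) =
      metricStructureOf ⟨orbitPseudometric φ o, orbitPseudometric_mem_hypPseudometrics φ o⟩ :=
  Quotient.sound (roughlySimilar_orbitPseudometric φ _ _)

/-! ### Minimal displacement and translation length -/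

theorem bddBelow_displacement (f : UpperHalfPlane ≃ᵢ UpperHalfPlane) :
    BddBelow (Set.range fun z => dist z (f z)) :=
  ⟨0, by rintro _ ⟨z, rfl⟩; exact dist_nonneg⟩

/-- The midpoint of `z` and `f z` is moved by `f` at most half as far as `z` by `f * f`. -/
theorem two_mul_iInf_displacement_le (f : UpperHalfPlane ≃ᵢ UpperHalfPlane) :
    2 * ⨅ z, dist z (f z) ≤ ⨅ z, dist z ((f * f) z) := by
  refine le_ciInf fun z => ?_
  obtain ⟨m, hm⟩ := exists_isMidpoint z (f z)
  have h1 := dist_midpoints_le hm (hm.map f)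
  have h2 := ciInf_le (bddBelow_displacement f) m
  rw [IsometryEquiv.mul_apply]
  linarith

theorem two_pow_mul_iInf_displacement_le (f : UpperHalfPlane ≃ᵢ UpperHalfPlane) (k : ℕ) :
    2 ^ k * ⨅ z, dist z (f z) ≤ ⨅ z, dist z ((f ^ 2 ^ k) z) := by
  induction k with
  | zero => simp
  | succ k ih =>
    have := two_mul_iInf_displacement_le (f ^ 2 ^ k)
    rw [← sq, ← pow_mul, ← pow_succ] at this
    rw [pow_succ]
    linarith

theorem geodesicLength_eq_translationLength (φ : SurfaceAction G) (o : UpperHalfPlane) (g : G) :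
    geodesicLength (teichmullerPoint φ) g = translationLength (orbitPseudometric φ o) g := by
  change ⨅ z, dist z (φ.1 g z) = _
  have hp := isPseudometric_orbitPseudometric φ
  have hl := isLeftInvariant_orbitPseudometric φ
  apply le_antisymm
  · have h1 : Tendsto (fun k : ℕ => 2 ^ k) atTop (atTop : Filter ℕ) :=
      tendsto_pow_atTop_atTop_of_one_lt one_lt_two
    refine ge_of_tendsto' ((tendsto_translationLength (hp o) (hl o) g).comp h1) fun k => ?_
    have h2 := two_pow_mul_iInf_displacement_le (φ.1 g) k
    have h3 := ciInf_le (bddBelow_displacement (φ.1 g ^ 2 ^ k)) o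
    have h4 : orbitPseudometric φ o (g ^ 2 ^ k) 1 = dist o ((φ.1 g ^ 2 ^ k) o) := by
      rw [(hp o).symm, orbitPseudometric_one_left, map_pow]
    simp only [Function.comp_apply]
    rw [h4, le_div_iff₀ (by positivity), mul_comm]
    push_cast
    exact h2.trans h3
  · refine le_ciInf fun z => ?_
    have h1 := translationLength_le (hp z) (hl z) g
    rw [(hp z).symm, orbitPseudometric_one_left] at h1
    have h2 := translationLength_le_mul (L := 1) (hp o) (hl o) (hp z) (hl z)
      (fun x y => by rw [one_mul]; exact orbitPseudometric_le_add φ o z x y) g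
    linarith

/-! ### Thurston's metric -/

theorem geodesicLengthRatio_le_Dil (φ ψ : SurfaceAction G) (o : UpperHalfPlane)
    (hne : ¬ IsVirtuallyAbelian G) (g : G) :
    geodesicLength (teichmullerPoint ψ) g / geodesicLength (teichmullerPoint φ) g ≤
      Dil (orbitPseudometric ψ o) (orbitPseudometric φ o) := by
  have hφ := orbitPseudometric_mem_hypPseudometrics φ o
  have hψ := orbitPseudometric_mem_hypPseudometrics ψ o
  rw [geodesicLength_eq_translationLength ψ o, geodesicLength_eq_translationLength φ o]
  exact div_le_of_le_mul₀ (translationLength_nonneg hφ.1 hφ.2.2.1 g) (Dil_pos hψ hφ hne).le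
    (translationLength_le_Dil_mul hψ hφ g)

theorem bddAbove_geodesicLengthRatios (φ ψ : SurfaceAction G) (hne : ¬ IsVirtuallyAbelian G) :
    BddAbove (geodesicLengthRatios (teichmullerPoint φ) (teichmullerPoint ψ)) := by
  refine ⟨Dil (orbitPseudometric ψ UpperHalfPlane.I) (orbitPseudometric φ UpperHalfPlane.I), ?_⟩
  rintro _ ⟨g, -, rfl⟩
  exact geodesicLengthRatio_le_Dil φ ψ UpperHalfPlane.I hne g

/-- A nontrivial element of finite order, which a free action in fact excludes, would only
contribute the ratio `0 / 0 = 0`. As all ratios are nonnegative, this does not affect the supremum,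
so the absence of torsion need not be used. -/
theorem sSup_geodesicLengthRatios (φ ψ : SurfaceAction G) (o : UpperHalfPlane)
    (hne : ¬ IsVirtuallyAbelian G) :
    sSup (geodesicLengthRatios (teichmullerPoint φ) (teichmullerPoint ψ)) =
      Dil (orbitPseudometric ψ o) (orbitPseudometric φ o) := by
  have hsub : lengthRatios (orbitPseudometric ψ o) (orbitPseudometric φ o) ⊆
      geodesicLengthRatios (teichmullerPoint φ) (teichmullerPoint ψ) := by
    rintro _ ⟨x, hx, rfl⟩
    refine ⟨x, fun h => hx (h ▸ IsOfFinOrder.one), ?_⟩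
    rw [geodesicLength_eq_translationLength ψ o, geodesicLength_eq_translationLength φ o]
  obtain ⟨r, hr, -⟩ := exists_pos_mem_lengthRatios
    (orbitPseudometric_mem_hypPseudometrics ψ o) (orbitPseudometric_mem_hypPseudometrics φ o) hne
  refine le_antisymm (csSup_le ⟨r, hsub hr⟩ ?_)
    (csSup_le_csSup (bddAbove_geodesicLengthRatios φ ψ hne) ⟨r, hr⟩ hsub)
  rintro _ ⟨g, -, rfl⟩
  exact geodesicLengthRatio_le_Dil φ ψ o hne g

theorem Del_teichmullerMetricStructure (φ ψ : SurfaceAction G) (hne : ¬ IsVirtuallyAbelian G) :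
    Del (teichmullerMetricStructure (teichmullerPoint φ))
        (teichmullerMetricStructure (teichmullerPoint ψ)) =
      2 * symThurstonDist (teichmullerPoint φ) (teichmullerPoint ψ) := by
  have hφ := orbitPseudometric_mem_hypPseudometrics φ UpperHalfPlane.I
  have hψ := orbitPseudometric_mem_hypPseudometrics ψ UpperHalfPlane.I
  have h : Del (teichmullerMetricStructure (teichmullerPoint φ))
      (teichmullerMetricStructure (teichmullerPoint ψ)) =
      Real.log (sInf (qiConstants (orbitPseudometric φ UpperHalfPlane.I)
        (orbitPseudometric ψ UpperHalfPlane.I))) := rfl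
  rw [h, sInf_qiConstants hφ hψ hne, Real.log_mul (Dil_pos hφ hψ hne).ne' (Dil_pos hψ hφ hne).ne',
    symThurstonDist, thurstonDist, thurstonDist,
    sSup_geodesicLengthRatios φ ψ UpperHalfPlane.I hne,
    sSup_geodesicLengthRatios ψ φ UpperHalfPlane.I hne]
  ring

end Surface
end HypGroup

open HypGroup
theorem proposition3p4 {G : Type*} [Group G] (hG : IsHyperbolicGroup G)
    (hne : ¬ IsVirtuallyAbelian G) :
    (∀ (ρ ρ' : MetricStructure G) (d d' : hypPseudometrics G),
      metricStructureOf d = ρ → metricStructureOf d' = ρ' →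
        (lengthRatios d.1 d'.1).Nonempty ∧ BddAbove (lengthRatios d.1 d'.1) ∧
        (qiConstants d.1 d'.1).Nonempty ∧
        Lam ρ ρ' = Dil d.1 d'.1 * Dil d'.1 d.1) ∧
    ∃ ι : TeichmullerSpace G → MetricStructure G,
      (∀ (φ : SurfaceAction G) (o : UpperHalfPlane),
        ∃ h : orbitPseudometric φ o ∈ hypPseudometrics G,
          ι (teichmullerPoint φ) = metricStructureOf ⟨orbitPseudometric φ o, h⟩) ∧
      ∀ X Y : TeichmullerSpace G,
        BddAbove (geodesicLengthRatios X Y) ∧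
        Del (ι X) (ι Y) = 2 * symThurstonDist X Y := by
  refine ⟨?_, teichmullerMetricStructure, fun φ o =>
    ⟨orbitPseudometric_mem_hypPseudometrics φ o, teichmullerMetricStructure_teichmullerPoint φ o⟩,
    fun X Y => ?_⟩
  · rintro _ _ d d' rfl rfl
    obtain ⟨r, hr, -⟩ := exists_pos_mem_lengthRatios d.2 d'.2 hne
    exact ⟨⟨r, hr⟩, bddAbove_lengthRatios d.2 d'.2,
      ⟨_, Dil_mul_Dil_mem_qiConstants d.2 d'.2 hne⟩, sInf_qiConstants d.2 d'.2 hne⟩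
  · induction X using Quotient.inductionOn with | h φ => ?_
    induction Y using Quotient.inductionOn with | h ψ => ?_
    exact ⟨bddAbove_geodesicLengthRatios φ ψ hne, Del_teichmullerMetricStructure φ ψ hne⟩
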